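/- Words are over the alphabet $\{0,1\}$. For a finite or infinite word $w$ let $\mathcal L(w)$ be the set of its finite factors. A subshift is a set of the form $\{w\in\{0,1\}^{\mathbb N}: \mathcal L(w)\subseteq F\}$ for a set $F$ of finite words; the subshift generated by an infinite word $w$ is $\Omega_w=\{v:\mathcal L(v)\subseteq\mathcal L(w)\}$; a subshift is minimal if it has no nonempty subshift as a proper subset. A square is a word $uu$ with $u$ nonempty, and it is minimal if no proper prefix of it is a square. An infinite word is squareful if a square begins at each of its positions and only finitely many distinct minimal squares occur in it. If $w=X_1^2X_2^2X_3^2\cdots$ with all $X_i^2$ minimal squares, then $\sqrt w=X_1X_2X_3\cdots$. A Sturmian word of slope $\alpha\in(0,1)\setminus\mathbb Q$ is a coding $s$ of an orbit $x, x+\alpha, x+2\alpha,\dots$ of the rotation by $\alpha$ on $\mathbb R/\mathbb Z$ with respect to the intervals $I_0=[0,1-\alpha)$, $I_1=[1-\alpha,1)$ or $I_0=(0,1-\alpha]$, $I_1=(1-\alpha,1]$ (the $n$-th letter of $s$ is $i$ if $x+n\alpha\in I_i$); $\mathcal L(\alpha)$ is the set of all factors of such words. A Sturmian subshift is a subshift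 generated by a Sturmian word. For integers $a\ge1$, $b\ge0$ let $$S_1=0,\quad S_2=010^{a-1},\quad S_3=010^{a},\quad S_4=10^{a},\quad S_5=10^{a+1}(10^a)^b,\quad S_6=10^{a+1}(10^a)^{b+1}.$$ A seed solution with parameters $a,b$ is a primitive word $S$ with $|S|>|S_6|$ which can be written as $S=X_1\cdots X_n$ with $X_1,\dots,X_n\in\{S_1,\dots,S_6\}$ and $X_1^2\cdots X_n^2=(X_1\cdots X_n)^2$, and for which $S^2\in\mathcal L(\alpha)$ for some irrational $\alpha$ with continued fraction expansion $[0;a+1,b+1,\dots]$. Let $L(w)$ be the word obtained from $w$ by exchanging its first two letters. Given a seed solution $S$, put $\gamma_1=S$ and $\gamma_{k+1}=L(\gamma_k)\gamma_k^2$ for $k\ge1$, and let $\Gamma$ be either of the infinite words $\Gamma_1=\lim_k\gamma_{2k}$, $\Gamma_2=\lim_k\gamma_{2k+1}$. Proposition. Seed solutions exist (for some $a\ge1$, $b\ge0$). For every $a\ge1$, $b\ge0$, every seed solution $S$ with parameters $a,b$, and each choice of $\Gamma$, the set $\Omega=\Omega_\Gamma\cup\Omega_{S^\omega}$ is a subshift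 which is not minimal, which is not a Sturmian subshift and in fact contains no Sturmian word, all of whose words are squareful and have a unique square root, and which satisfies $\sqrt\Omega\subseteq\Omega$. In particular, there exists a non-minimal, non-Sturmian subshift $\Omega$ of squareful words such that $\sqrt\Omega\subseteq\Omega$. -/

import Mathlib

/-! # Combinatorics on binary words, the square root map, and the words `Γ` -/

namespace SquareRootMap

/-- Finite words over the alphabet `{0, 1}`. -/
abbrev Word := List (Fin 2)

/-- Infinite words over the alphabet `{0, 1}`. -/
abbrev InfWord := ℕ → Fin 2

/-- The factor of length `n` of the infinite word `w` starting at position `i`. -/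
def factorAt (w : InfWord) (i n : ℕ) : Word := (List.range n).map fun j => w (i + j)

/-- The set of factors of an infinite word. -/
def language (w : InfWord) : Set Word := {u | ∃ i n, u = factorAt w i n}

/-- The finite word `u` is a prefix of the infinite word `w`. -/
def IsPrefixOf (u : Word) (w : InfWord) : Prop := factorAt w 0 u.length = u

/-- The `n`-th power `u ⋯ u` of a finite word. -/
def wordPow (u : Word) (n : ℕ) : Word := (List.replicate n u).flatten

/-- A word is primitive if it is of the form `z ^ n` only for `n = 1`. -/
def IsPrimitive (w : Word) : Prop := ∀ (z : Word) (n : ℕ), w = wordPow z n → n = 1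

/-- The periodic infinite word `v ^ ω` (meant for nonempty `v`). -/
def omegaPow (v : Word) : InfWord := fun n => v.getD (n % v.length) 0

/-! ## Subshifts -/

/-- A subshift is the set of all infinite words whose factors lie in a given set of words. -/
def IsSubshift (Ω : Set InfWord) : Prop := ∃ F : Set Word, Ω = {w | language w ⊆ F}

/-- The subshift generated by an infinite word. -/
def subshiftOf (w : InfWord) : Set InfWord := {v | language v ⊆ language w}

/-- A subshift is minimal if no nonempty subshift is a proper subset of it. -/
def IsMinimalSubshift (Ω : Set InfWord) : Prop :=
  IsSubshift Ω ∧ ∀ Ω' : Set InfWord, IsSubshift Ω' → Ω'.Nonempty → ¬ Ω' ⊂ Ω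

/-! ## Minimal squares, squareful words, and the square root map -/

/-- `s` is a square `u u` with `u` nonempty. -/
def IsSquareWord (s : Word) : Prop := ∃ u : Word, u ≠ [] ∧ s = u ++ u

/-- A square is minimal if no proper prefix of it is a square. -/
def IsMinimalSquare (s : Word) : Prop :=
  IsSquareWord s ∧ ∀ t : Word, t <+: s → IsSquareWord t → t = s

/-- Every position of a squareful word starts a square, and only finitely many distinct minimal
squares occur in it. -/
def IsSquareful (w : InfWord) : Prop :=
  (∀ i, ∃ n, IsSquareWord (factorAt w i n)) ∧ {s | s ∈ language w ∧ IsMinimalSquare s}.Finite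

/-- `w` is the infinite product `X 0 · X 1 · X 2 ⋯` (meant for nonempty factors `X i`). -/
def IsInfProduct (X : ℕ → Word) (w : InfWord) : Prop :=
  ∀ n, IsPrefixOf ((List.range n).flatMap X) w

/-- `v` is a square root of `w`: one has `w = X₀² X₁² X₂² ⋯` and `v = X₀ X₁ X₂ ⋯`, where all the
squares `Xᵢ²` are minimal. -/
def IsSquareRoot (v w : InfWord) : Prop :=
  ∃ X : ℕ → Word, (∀ i, IsMinimalSquare (X i ++ X i)) ∧
    IsInfProduct (fun i => X i ++ X i) w ∧ IsInfProduct X v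

/-- The image `√Ω` of a set of infinite words. -/
def sqrtImage (Ω : Set InfWord) : Set InfWord := {v | ∃ w ∈ Ω, IsSquareRoot v w}

/-! ## Sturmian words -/

open Classical in
/-- Coding of the orbit of `x` under the rotation by `α`, with intervals `I₀ = [0, 1 - α)` and
`I₁ = [1 - α, 1)`. -/
noncomputable def lowerCoding (α x : ℝ) : InfWord := fun n =>
  if Int.fract (x + n * α) < 1 - α then 0 else 1

open Classical in
/-- Coding of the orbit of `x` under the rotation by `α`, with intervals `I₀ = (0, 1 - α]` and
`I₁ = (1 - α, 1]`, where the point `0` of the circle is identified with `1`. -/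
noncomputable def upperCoding (α x : ℝ) : InfWord := fun n =>
  if 0 < Int.fract (x + n * α) ∧ Int.fract (x + n * α) ≤ 1 - α then 0 else 1

/-- Sturmian words of slope `α`: codings of irrational rotations by `α`. -/
def IsSturmianOfSlope (α : ℝ) (w : InfWord) : Prop :=
  Irrational α ∧ 0 < α ∧ α < 1 ∧ ∃ x : ℝ, w = lowerCoding α x ∨ w = upperCoding α x

/-- Sturmian words (of any slope). -/
def IsSturmian (w : InfWord) : Prop := ∃ α : ℝ, IsSturmianOfSlope α w

/-- The language of slope `α`: all factors of Sturmian words of slope `α`. -/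
def slopeLanguage (α : ℝ) : Set Word := {u | ∃ w, IsSturmianOfSlope α w ∧ u ∈ language w}

/-- A Sturmian subshift is a subshift generated by a Sturmian word. -/
def IsSturmianSubshift (Ω : Set InfWord) : Prop := ∃ w, IsSturmian w ∧ Ω = subshiftOf w

/-- `α` is an irrational number with continued fraction expansion `[0; a₁, a₂, …]`. -/
def HasExpansion (α : ℝ) (a₁ a₂ : ℕ) : Prop :=
  Irrational α ∧ 0 < α ∧ α < 1 ∧
    (GenContFract.of α).partDens.get? 0 = some (a₁ : ℝ) ∧
    (GenContFract.of α).partDens.get? 1 = some (a₂ : ℝ)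

/-! ## Minimal square roots with parameters, seed solutions -/

/-- The word `1 0 ^ n`. -/
def oneZeros (n : ℕ) : Word := 1 :: List.replicate n 0

/-- The word `S₆ = 1 0^(a+1) (1 0^a)^(b+1)`. -/
def S6 (a b : ℕ) : Word := oneZeros (a + 1) ++ wordPow (oneZeros a) (b + 1)

/-- The six minimal square roots with parameters `a ≥ 1` and `b ≥ 0`:
`0`, `010^(a-1)`, `010^a`, `10^a`, `10^(a+1)(10^a)^b`, `10^(a+1)(10^a)^(b+1)`. -/
def minimalSquareRoots (a b : ℕ) : Set Word :=
  {[0], 0 :: oneZeros (a - 1), 0 :: oneZeros a, oneZeros a,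
    oneZeros (a + 1) ++ wordPow (oneZeros a) b, S6 a b}

/-- `w` is a nonempty product `X₁ ⋯ Xₙ` of minimal square roots that satisfies the word equation
`X₁² ⋯ Xₙ² = (X₁ ⋯ Xₙ)²`. -/
def IsSolution (a b : ℕ) (w : Word) : Prop :=
  w ≠ [] ∧ ∃ X : List Word, (∀ u ∈ X, u ∈ minimalSquareRoots a b) ∧ w = X.flatten ∧
    X.flatMap (fun u => u ++ u) = w ++ w

/-- Seed solutions with parameters `a` and `b`: primitive solutions `S` of the word equation in the
language of some slope `[0; a + 1, b + 1, …]` with `|S| > |S₆|`. -/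
def IsSeed (a b : ℕ) (S : Word) : Prop :=
  IsPrimitive S ∧ IsSolution a b S ∧ (S6 a b).length < S.length ∧
    ∃ α : ℝ, HasExpansion α (a + 1) (b + 1) ∧ S ++ S ∈ slopeLanguage α

/-! ## The words `γₖ` and `Γ` -/

/-- The word `L(w)` obtained from `w` by exchanging its first two letters. -/
def exchange : Word → Word
  | x :: y :: t => y :: x :: t
  | t => t

/-- The words `γ₁ = S`, `γₖ₊₁ = L(γₖ) γₖ²`, numbered from zero: `gammaWord S k` is `γₖ₊₁`. -/
def gammaWord (S : Word) : ℕ → Word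
  | 0 => S
  | k + 1 => exchange (gammaWord S k) ++ (gammaWord S k ++ gammaWord S k)

/-- The two limit words: `gammaLimit S r` is the limit of the words `gammaWord S (2 * k + r)` as `k`
tends to infinity. So `r = 1` gives `Γ₁ = lim γ₂ₖ`, and `r = 0` gives `Γ₂ = lim γ₂ₖ₊₁`. -/
def gammaLimit (S : Word) (r : ℕ) : InfWord := fun n => (gammaWord S (2 * (n + 1) + r)).getD n 0

theorem exchange_append (u v : Word) (hu : 2 ≤ u.length) :
    exchange (u ++ v) = exchange u ++ v := by
  match u, hu with
  | x :: y :: t, _ => rfl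

theorem exchange_exchange (u : Word) : exchange (exchange u) = u := by
  match u with
  | [] => rfl
  | [_] => rfl
  | _ :: _ :: _ => rfl

theorem length_exchange (u : Word) : (exchange u).length = u.length := by
  match u with
  | [] => rfl
  | [_] => rfl
  | _ :: _ :: _ => rfl

theorem length_gammaWord (S : Word) (k : ℕ) : (gammaWord S k).length = 3 ^ k * S.length := by
  induction k with
  | zero => simp [gammaWord]
  | succ k ih => simp [gammaWord, length_exchange, ih]; ring

theorem gammaWord_prefix (S : Word) (hS : 2 ≤ S.length) (k : ℕ) :
    gammaWord S k ++ gammaWord S k <+: gammaWord S (k + 2) := by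
  have h2 : 2 ≤ (exchange (gammaWord S k)).length := by
    rw [length_exchange, length_gammaWord]
    exact le_trans hS (Nat.le_mul_of_pos_left _ (by positivity))
  refine ⟨gammaWord S k ++ (gammaWord S (k + 1) ++ gammaWord S (k + 1)), ?_⟩
  change _ = exchange (exchange (gammaWord S k) ++ (gammaWord S k ++ gammaWord S k)) ++ _
  rw [exchange_append _ _ h2, exchange_exchange]
  simp only [List.append_assoc]

theorem gammaWord_prefix_of_le (S : Word) (hS : 2 ≤ S.length) (r k l : ℕ) (h : k ≤ l) :
    gammaWord S (2 * k + r) <+: gammaWord S (2 * l + r) := by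
  induction l, h using Nat.le_induction with
  | base => exact List.prefix_rfl
  | succ l _ ih =>
    have h1 := gammaWord_prefix S hS (2 * l + r)
    have h2 : 2 * (l + 1) + r = 2 * l + r + 2 := by ring
    rw [h2]
    exact ih.trans ((List.prefix_append _ _).trans h1)

/-- The limits exist: every `gammaWord S (2 * k + r)` is a prefix of `gammaLimit S r`. -/
theorem gammaWord_isPrefixOf_gammaLimit (S : Word) (hS : 2 ≤ S.length) (r k : ℕ) :
    IsPrefixOf (gammaWord S (2 * k + r)) (gammaLimit S r) := by
  unfold IsPrefixOf factorAt
  refine List.ext_getElem (by simp) ?_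
  intro n h1 h2
  have hlen : n < (gammaWord S (2 * (n + 1) + r)).length := by
    rw [length_gammaWord]
    have h3 : n < 3 ^ n := Nat.lt_pow_self (by norm_num)
    have h4 : 3 ^ n ≤ 3 ^ (2 * (n + 1) + r) := Nat.pow_le_pow_right (by norm_num) (by omega)
    nlinarith
  simp only [List.getElem_map, List.getElem_range, gammaLimit, Nat.zero_add]
  rw [List.getD_eq_getElem _ _ hlen]
  rcases le_total k (n + 1) with h | h
  · exact ((gammaWord_prefix_of_le S hS r k (n + 1) h).getElem h2).symm
  · exact (gammaWord_prefix_of_le S hS r (n + 1) k h).getElem hlen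

/-- The subshift `Ω`: the union of the subshifts generated by `Γ` and by `S ^ ω`. -/
def unionSubshift (S : Word) (r : ℕ) : Set InfWord :=
  subshiftOf (gammaLimit S r) ∪ subshiftOf (omegaPow S)

end SquareRootMap

namespace SquareRootMap

/-! Everything is read off the prefix counts `ones w n`. In a word with `RunBounds`, a minimal
square `XX` satisfies 2H(j) - 1 ≤ H(2j - 1) ≤ 2H(j) for 1 ≤ j ≤ |X|, where H counts the letters 1
from its start. Summing over the factorization into squares, a root v of w has `ones v j` = ⌈`ones w
(2j - 1)` / 2⌉ (`IsSquareRoot.ones_bounds`). So the root is unique, and taking it halves the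
intercept of the line that w follows.

Put q = |S| and let h be the number of letters 1 in S. The words S₁, …, S₆ satisfy the same
inequalities, and the word equation passes them on to S and S^ω. A bounded deviation that doubles
with the index must stay in [0, q], so (n - 1)h ≤ q · `ones` n ≤ (n - 1)h + q for S^ω
(`Doubles.ones_bounds`). Primitivity and S² ∈ 𝓛(α) give gcd(q, h) = 1. Hence the counts are forced
except at n = kq + 1: the only freedom is the first letter c(k) of each block (`IsBlockWord`).
Exchanging the first two letters of a block uses just this freedom, so Γ follows the same line. Its
block k ≥ 1 is S exchanged v₃(k) times.

A factor of Γ at position i has intercept ih - q · `ones` i, and a root has half of it. If this is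
odd, the halved line misses all ambiguous points and the root lies in Ω_{S^ω}. If it is even, the
root again has block form, and c(2k) = c(k) together with the odd almost-periods 3^N of c places it
in Ω_Γ (`IsBlockWord.root_mem`).

Blocks k ≡ 1 mod 3 of Γ are never exchanged, so each word of Ω has a constant letter along some
arithmetic progression. An irrational rotation is dense along progressions, so no such word is
Sturmian. Finally Γ is not q-periodic, so Ω_{S^ω} is a proper subshift of Ω. -/

/-! ### Prefix counts, factors and subshifts. -/

/-- The number of letters `1` among the first `n` letters of `w`. -/
def ones (w : InfWord) (n : ℕ) : ℤ := ∑ j ∈ Finset.range n, ((w j).val : ℤ)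

/-- The infinite word obtained by deleting the first `i` letters. -/
def shift (w : InfWord) (i : ℕ) : InfWord := fun n => w (i + n)

@[simp] theorem ones_zero (w : InfWord) : ones w 0 = 0 := by simp [ones]

theorem ones_succ (w : InfWord) (n : ℕ) : ones w (n + 1) = ones w n + (w n).val := by
  simp [ones, Finset.sum_range_succ]

theorem ones_step (w : InfWord) (n : ℕ) :
    ones w n ≤ ones w (n + 1) ∧ ones w (n + 1) ≤ ones w n + 1 := by
  have := (w n).isLt
  rw [ones_succ]
  omega

theorem ones_shift (w : InfWord) (i n : ℕ) : ones (shift w i) n = ones w (i + n) - ones w i := by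
  induction n with
  | zero => simp
  | succ n ih => rw [ones_succ, ih, ← add_assoc, ones_succ]; simp only [shift]; ring

theorem letter_eq_of_ones {u w : InfWord} {n m : ℕ}
    (h : ones u (n + 1) - ones u n = ones w (m + 1) - ones w m) : u n = w m := by
  rw [ones_succ, ones_succ] at h
  apply Fin.ext
  omega

theorem ones_congr {u w : InfWord} {i n : ℕ} (h : ∀ s < n, u s = w (i + s)) :
    ∀ s ≤ n, ones u s = ones w (i + s) - ones w i := by
  intro s
  induction s with
  | zero => simp
  | succ s ih =>
    intro hs
    rw [ones_succ, ih (by omega), ← add_assoc, ones_succ, h s (by omega)]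
    ring

theorem length_factorAt (w : InfWord) (i n : ℕ) : (factorAt w i n).length = n := by
  simp [factorAt]

theorem factorAt_eq_iff {u w : InfWord} {i j n : ℕ} :
    factorAt u i n = factorAt w j n ↔ ∀ s < n, u (i + s) = w (j + s) := by
  simp [factorAt]

theorem isPrefixOf_iff {u : Word} {w : InfWord} :
    IsPrefixOf u w ↔ ∀ s (hs : s < u.length), w s = u[s] := by
  constructor
  · intro h s hs
    have h1 : (factorAt w 0 u.length)[s]'(by simpa [factorAt] using hs) = u[s] := by
      simp only [IsPrefixOf] at h
      simp only [h]
    simpa [factorAt] using h1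
  · intro h
    refine List.ext_getElem (by simp [factorAt]) ?_
    intro s h1 h2
    simpa [factorAt] using h s h2

theorem mem_subshiftOf_iff {v w : InfWord} :
    v ∈ subshiftOf w ↔ ∀ n, ∃ i, ∀ s < n, v s = w (i + s) := by
  constructor
  · intro h n
    obtain ⟨i, m, him⟩ := h ⟨0, n, rfl⟩
    have hm : n = m := by simpa [factorAt] using congrArg List.length him
    subst hm
    exact ⟨i, by simpa using factorAt_eq_iff.1 him⟩
  · rintro h _ ⟨i, n, rfl⟩
    obtain ⟨k, hk⟩ := h (i + n)
    refine ⟨k + i, n, factorAt_eq_iff.2 fun s hs => ?_⟩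
    rw [hk _ (by omega), add_assoc]

theorem self_mem_subshiftOf (w : InfWord) : w ∈ subshiftOf w := fun _ h => h

theorem isSubshift_subshiftOf (w : InfWord) : IsSubshift (subshiftOf w) := ⟨language w, rfl⟩

/-- A word whose prefixes are factors of `u` or `w` has all its factors in a single one of the two
languages. -/
theorem mem_union_of_prefixes {u w v : InfWord}
    (h : ∀ n, (∃ i, ∀ s < n, v s = u (i + s)) ∨ ∃ i, ∀ s < n, v s = w (i + s)) :
    v ∈ subshiftOf u ∪ subshiftOf w := by
  by_cases hu : ∀ n, ∃ i, ∀ s < n, v s = u (i + s)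
  · exact Or.inl (mem_subshiftOf_iff.2 hu)
  -- If the prefix of length `m` is no factor of `u`, neither is any longer one, so all of those
  -- come from `w`.
  · obtain ⟨m, hm⟩ := not_forall.1 hu
    refine Or.inr (mem_subshiftOf_iff.2 fun n => ?_)
    rcases h (n + m) with ⟨i, hi⟩ | ⟨i, hi⟩
    · exact absurd ⟨i, fun s hs => hi s (by omega)⟩ hm
    · exact ⟨i, fun s hs => hi s (by omega)⟩

theorem isSubshift_union (u w : InfWord) : IsSubshift (subshiftOf u ∪ subshiftOf w) := by
  refine ⟨language u ∪ language w, Set.Subset.antisymm ?_ ?_⟩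
  · rintro v (hv | hv)
    · exact hv.trans Set.subset_union_left
    · exact hv.trans Set.subset_union_right
  · intro v hv
    refine mem_union_of_prefixes fun n => ?_
    rcases hv ⟨0, n, rfl⟩ with ⟨i, m, him⟩ | ⟨i, m, him⟩
    all_goals
      have hm : n = m := by simpa [factorAt] using congrArg List.length him
      subst hm
    · exact Or.inl ⟨i, by simpa using factorAt_eq_iff.1 him⟩
    · exact Or.inr ⟨i, by simpa using factorAt_eq_iff.1 him⟩

/-! ### Run bounds and the short square at the start of a word. -/

/-- The prefix counts of `1` of an infinite word in which each long run of zeros `0 ^ A` is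
followed by `b` or `b + 1` short runs `0 ^ (A - 1)`. -/
structure RunBounds (A b : ℕ) (H : ℕ → ℤ) : Prop where
  zero : H 0 = 0
  step : ∀ n, H n ≤ H (n + 1) ∧ H (n + 1) ≤ H n + 1
  short : ∀ n, H (n + A) ≤ H n + 1
  upper : ∀ n, H (n + ((b + 2) * A + 1)) ≤ H n + (b + 2)
  lower : ∀ n, H n + (b + 1) ≤ H (n + ((b + 1) * A + 1))

namespace RunBounds

variable {A b : ℕ} {H : ℕ → ℤ}

theorem mono (hH : RunBounds A b H) {m n : ℕ} (h : m ≤ n) : H m ≤ H n :=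
  monotone_nat_of_le_succ (fun n => (hH.step n).1) h

theorem short_mul (hH : RunBounds A b H) (n k : ℕ) : H (n + k * A) ≤ H n + k := by
  induction k with
  | zero => simp
  | succ k ih =>
    have := hH.short (n + k * A)
    rw [show n + (k + 1) * A = n + k * A + A by ring]
    push_cast
    linarith

/-- Each window of length `A` cut off the end of the long window of `lower` removes at most one
letter 1. -/
theorem lower_mul (hH : RunBounds A b H) (n k : ℕ) (hk : k ≤ b) :
    H n + (k + 1) ≤ H (n + ((k + 1) * A + 1)) := by
  obtain ⟨d, rfl⟩ := Nat.exists_eq_add_of_le hk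
  have h1 := hH.short_mul (n + ((k + 1) * A + 1)) d
  have h2 := hH.lower n
  rw [show n + ((k + 1) * A + 1) + d * A = n + ((k + d + 1) * A + 1) by ring] at h1
  push_cast at h2
  linarith

/-- After a position where a run `1 0 ^ A` starts, the counts are determined up to the next such
run. -/
theorem long_run (hH : RunBounds A b H) {M : ℕ} (h1 : H (M + 1) = H M + 1)
    (hA : H (M + A + 1) = H M + 1) (k : ℕ) :
    H (M + ((k + 1) * A + 1)) ≤ H M + (k + 1) ∧
      (k ≤ b → H M + (k + 2) ≤ H (M + ((k + 1) * A + 2))) := by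
  constructor
  · have := hH.short_mul (M + A + 1) k
    rw [show M + A + 1 + k * A = M + ((k + 1) * A + 1) by ring] at this
    linarith
  · intro hk
    have := hH.lower_mul (M + 1) k hk
    rw [show M + 1 + ((k + 1) * A + 1) = M + ((k + 1) * A + 2) by ring] at this
    linarith

/-- The upper bound of `long_run` at the right end of the range meets its lower bound at the left
end, so monotonicity pins the count. -/
theorem long_run_eq (hH : RunBounds A b H) {M : ℕ} (h1 : H (M + 1) = H M + 1)
    (hA : H (M + A + 1) = H M + 1) {k j : ℕ} (hk : k ≤ b) (hj : k * A + 2 ≤ j)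
    (hj' : j ≤ (k + 1) * A + 1) : H (M + j) = H M + (k + 1) := by
  apply le_antisymm
  · exact (hH.mono (by omega)).trans (hH.long_run h1 hA k).1
  · rcases k with _ | k
    · have : H (M + 1) ≤ H (M + j) := hH.mono (by omega)
      push_cast
      linarith
    · have h2 := (hH.long_run h1 hA k).2 (by omega)
      have h3 : H (M + ((k + 1) * A + 2)) ≤ H (M + j) := hH.mono (by omega)
      push_cast
      linarith

theorem exists_index (hA : 1 ≤ A) {c j : ℕ} (hj : 2 ≤ j) (hj' : j ≤ (c + 1) * A + 1) :
    ∃ k ≤ c, k * A + 2 ≤ j ∧ j ≤ (k + 1) * A + 1 := by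
  refine ⟨(j - 2) / A, ?_, ?_, ?_⟩
  · have : j - 2 < (c + 1) * A := by omega
    have := (Nat.div_lt_iff_lt_mul hA).2 this
    omega
  · have := Nat.div_mul_le_self (j - 2) A
    omega
  · have h1 := Nat.div_add_mod (j - 2) A
    have h2 := Nat.mod_lt (j - 2) hA
    have h3 : ((j - 2) / A + 1) * A = A * ((j - 2) / A) + A := by ring
    omega

/-- In the presence of the run bounds, a square whose half has length at most
`(b + 2) * A + 1` starts at the beginning, and on this half the counts satisfy the doubling
inequalities. -/
theorem exists_root (hH : RunBounds A b H) (hA : 2 ≤ A) :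
    ∃ l, 1 ≤ l ∧ l ≤ (b + 2) * A + 1 ∧ (∀ j ≤ l, H (l + j) = H l + H j) ∧
      ∀ j, 1 ≤ j → j ≤ l → 2 * H j - 1 ≤ H (2 * j - 1) ∧ H (2 * j - 1) ≤ 2 * H j := by
  have z := hH.zero
  have s0 := hH.step 0
  have s1 := hH.step 1
  have bA : 2 * A ≤ (b + 2) * A := Nat.mul_le_mul_right _ (by omega)
  simp only [zero_add] at s0
  norm_num at s1
  -- The cases decide which of S₁, …, S₆ (with a = A - 1) is the half of the square. The witnesses
  -- are their lengths 1, A, A + 1, A, (b + 1)A + 1 and (b + 2)A + 1.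
  rcases (show H 1 = 0 ∨ H 1 = 1 by omega) with h1 | h1
  · rcases (show H 2 = 0 ∨ H 2 = 1 by omega) with h2 | h2
    · refine ⟨1, le_rfl, by omega, ?_, ?_⟩
      · intro j hj
        interval_cases j <;> simp [z, h1, h2]
      · intro j hj hj'
        obtain rfl : j = 1 := by omega
        simp [h1]
    · have t1 : H (A + 1) ≤ 1 := by
        have := hH.short 1
        rw [add_comm A 1]
        omega
      have eq1 : ∀ j, 2 ≤ j → j ≤ A + 1 → H j = 1 := fun j hj hj' => by
        have := hH.mono hj
        have := hH.mono hj'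
        omega
      have sA : H (A + 1) ≤ H (A + 2) ∧ H (A + 2) ≤ H (A + 1) + 1 := hH.step (A + 1)
      have eA := eq1 (A + 1) (by omega) le_rfl
      rcases (show H (A + 2) = 2 ∨ H (A + 2) = 1 by omega) with h3 | h3
      · have t2 : H (2 * A + 1) ≤ 2 := by
          have := hH.short (A + 1)
          rw [show A + 1 + A = 2 * A + 1 by ring] at this
          omega
        refine ⟨A, by omega, by omega, ?_, ?_⟩
        · intro j hj
          rw [eq1 A (by omega) (by omega)]
          rcases (show j = 0 ∨ j = 1 ∨ 2 ≤ j by omega) with rfl | rfl | hj2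
          · rw [z, add_zero, eq1 A (by omega) (by omega)]; rfl
          · rw [h1, eA]; rfl
          · rw [eq1 j hj2 (by omega)]
            have := hH.mono (show A + 2 ≤ A + j by omega)
            have := hH.mono (show A + j ≤ 2 * A + 1 by omega)
            omega
        · intro j hj hj'
          rcases (show j = 1 ∨ 2 ≤ j by omega) with rfl | hj2
          · simp [h1]
          · rw [eq1 j hj2 (by omega)]
            have := hH.mono (show 2 ≤ 2 * j - 1 by omega)
            have := hH.mono (show 2 * j - 1 ≤ 2 * A + 1 by omega)
            omega
      · have t2 : H (2 * A + 2) ≤ 2 := by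
          have := hH.short (A + 2)
          rw [show A + 2 + A = 2 * A + 2 by ring] at this
          omega
        have t3 : 2 ≤ H (A + 3) := by
          have := hH.lower_mul 2 0 (by omega)
          rw [show 2 + ((0 + 1) * A + 1) = A + 3 by ring] at this
          push_cast at this
          omega
        refine ⟨A + 1, by omega, by omega, ?_, ?_⟩
        · intro j hj
          rw [eA]
          rcases (show j = 0 ∨ j = 1 ∨ 2 ≤ j by omega) with rfl | rfl | hj2
          · rw [z, add_zero, eA]; rfl
          · rw [h1, h3]; rfl
          · rw [eq1 j hj2 (by omega)]
            have := hH.mono (show A + 3 ≤ A + 1 + j by omega)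
            have := hH.mono (show A + 1 + j ≤ 2 * A + 2 by omega)
            omega
        · intro j hj hj'
          rcases (show j = 1 ∨ 2 ≤ j by omega) with rfl | hj2
          · simp [h1]
          · rw [eq1 j hj2 (by omega)]
            have := hH.mono (show 2 ≤ 2 * j - 1 by omega)
            have := hH.mono (show 2 * j - 1 ≤ 2 * A + 2 by omega)
            omega
  · have tA : H A ≤ 1 := by
      have := hH.short 0
      simp only [zero_add, z] at this
      exact this
    have eq1 : ∀ j, 1 ≤ j → j ≤ A → H j = 1 := fun j hj hj' => by
      have := hH.mono hj
      have := hH.mono hj'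
      omega
    have eA := eq1 A (by omega) le_rfl
    have sA := hH.step A
    rcases (show H (A + 1) = 2 ∨ H (A + 1) = 1 by omega) with h2 | h2
    · have t2 : H (2 * A) ≤ 2 := by
        have := hH.short A
        rw [← two_mul] at this
        omega
      refine ⟨A, by omega, by omega, ?_, ?_⟩
      · intro j hj
        rcases (show j = 0 ∨ 1 ≤ j by omega) with rfl | hj2
        · simp [z]
        · rw [eA, eq1 j hj2 hj]
          have := hH.mono (show A + 1 ≤ A + j by omega)
          have := hH.mono (show A + j ≤ 2 * A by omega)
          omega
      · intro j hj hj'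
        rw [eq1 j hj hj']
        have := hH.mono (show 1 ≤ 2 * j - 1 by omega)
        have := hH.mono (show 2 * j - 1 ≤ 2 * A by omega)
        omega
    · have r1 : H (0 + 1) = H 0 + 1 := by simp [z, h1]
      have rA : H (0 + A + 1) = H 0 + 1 := by simp [z, h2]
      have up : ∀ k : ℕ, H ((k + 1) * A + 1) ≤ k + 1 := fun k => by
        simpa [z] using (hH.long_run r1 rA k).1
      have lo : ∀ k : ℕ, k ≤ b → (k + 2 : ℤ) ≤ H ((k + 1) * A + 2) := fun k hk => by
        simpa [z] using (hH.long_run r1 rA k).2 hk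
      have pin : ∀ k j : ℕ, k ≤ b → k * A + 2 ≤ j → j ≤ (k + 1) * A + 1 → H j = k + 1 :=
        fun k j hk hj hj' => by simpa [z] using hH.long_run_eq r1 rA hk hj hj'
      obtain ⟨N, hN⟩ : ∃ N, N = (b + 1) * A + 1 := ⟨_, rfl⟩
      have hN1 : H N = b + 1 := by
        have := hH.lower 0
        have := up b
        simp only [zero_add, z] at *
        rw [hN]
        omega
      have hN2 : H (N + 1) = b + 2 := by
        have h3 := lo b le_rfl
        rw [show (b + 1) * A + 2 = N + 1 by rw [hN]] at h3
        have := hH.step N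
        omega
      have sN := hH.step (N + A)
      have cN := hH.short N
      have cN1 := hH.short (N + 1)
      rw [show N + 1 + A = N + A + 1 by ring] at cN1
      have mN := hH.mono (show N + 1 ≤ N + A + 1 by omega)
      have NA : (b + 2) * A + 1 = N + A := by rw [hN]; ring
      have dup : ∀ k j : ℕ, k * A + 2 ≤ j → j ≤ (k + 1) * A + 1 → H (2 * j - 1) ≤ 2 * (k + 1) := by
        intro k j _ hj'
        have h3 := up (2 * k + 1)
        have h4 : (2 * k + 1 + 1) * A + 1 = 2 * ((k + 1) * A) + 1 := by ring
        have := hH.mono (show 2 * j - 1 ≤ (2 * k + 1 + 1) * A + 1 by omega)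
        push_cast at h3
        linarith
      have dlo : ∀ k j : ℕ, k * A + 2 ≤ j → H (2 * (k * A) + 3) ≤ H (2 * j - 1) := by
        intro k j hj
        exact hH.mono (by omega)
      have small : ∀ k : ℕ, 2 * k ≤ b + 1 → (2 * k + 1 : ℤ) ≤ H (2 * (k * A) + 3) := by
        intro k hk
        rcases Nat.eq_zero_or_pos k with rfl | hk0
        · have := hH.mono (show 1 ≤ 2 * (0 * A) + 3 by omega)
          push_cast
          omega
        · have h3 := lo (2 * k - 1) (by omega)
          have h4 : (2 * k - 1 + 1) * A = 2 * (k * A) := by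
            rw [Nat.sub_add_cancel (by omega)]; ring
          rw [h4] at h3
          have := hH.mono (show 2 * (k * A) + 2 ≤ 2 * (k * A) + 3 by omega)
          push_cast [show 1 ≤ 2 * k by omega] at h3
          linarith
      -- A letter 1 stands at N. If A zeros follow, the pattern 1 0^A restarts there and the half is
      -- S₅. Otherwise one more short run follows, the restart is at N + A, and the half is S₆.
      rcases (show H (N + A + 1) = b + 2 ∨ H (N + A + 1) = b + 3 by omega) with h3 | h3
      · have q1 : H (N + 1) = H N + 1 := by rw [hN1, hN2]; ring
        have qA : H (N + A + 1) = H N + 1 := by rw [hN1, h3]; ring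
        refine ⟨N, by omega, by omega, ?_, ?_⟩
        · intro j hj
          rcases (show j = 0 ∨ j = 1 ∨ 2 ≤ j by omega) with rfl | rfl | hj2
          · simp [z]
          · rw [q1, h1]
          · obtain ⟨k, hk, hk1, hk2⟩ := exists_index (by omega) hj2 (hj.trans hN.le)
            rw [hH.long_run_eq q1 qA hk hk1 hk2, pin k j hk hk1 hk2]
        · intro j hj hj'
          rcases (show j = 1 ∨ 2 ≤ j by omega) with rfl | hj2
          · simp [h1]
          · obtain ⟨k, hk, hk1, hk2⟩ := exists_index (by omega) hj2 (hj'.trans hN.le)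
            rw [pin k j hk hk1 hk2]
            refine ⟨?_, dup k j hk1 hk2⟩
            have h5 := dlo k j hk1
            rcases (show 2 * k ≤ b + 1 ∨ b + 2 ≤ 2 * k by omega) with h6 | h6
            · have := small k h6
              linarith
            -- Here the index 2kA + 3 already lies in the second copy of the half, so the count is
            -- taken from the restart at N.
            · have h7 := (hH.long_run q1 qA (2 * k - b - 2)).2 (by omega)
              have h8 : N + ((2 * k - b - 2 + 1) * A + 2) = 2 * (k * A) + 3 := by
                rw [hN]
                obtain ⟨d, hd⟩ := Nat.exists_eq_add_of_le h6
                rw [show 2 * (k * A) = (2 * k) * A by ring, hd,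
                  show b + 2 + d - b - 2 + 1 = d + 1 by omega]
                ring
              rw [h8, hN1] at h7
              push_cast [show b ≤ 2 * k by omega, show 2 ≤ 2 * k - b by omega] at h7
              linarith
      · have hM : H (N + A) = b + 2 := by omega
        have q1 : H (N + A + 1) = H (N + A) + 1 := by rw [hM, h3]; ring
        have qA : H (N + A + A + 1) = H (N + A) + 1 := by
          -- The window of `upper` placed right after the initial 1 0^A ends A letters after the 1
          -- at N + A and leaves no room for another 1 there.
          have h4 := hH.upper (A + 1)
          rw [show A + 1 + ((b + 2) * A + 1) = N + A + A + 1 by rw [NA]; ring, h2] at h4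
          have := hH.mono (show N + A + 1 ≤ N + A + A + 1 by omega)
          omega
        have pin2 : ∀ j, N + 1 ≤ j → j ≤ N + A → H j = b + 2 := fun j hj hj' => by
          have := hH.mono hj
          have := hH.mono hj'
          omega
        refine ⟨N + A, by omega, by omega, ?_, ?_⟩
        · intro j hj
          rcases (show j = 0 ∨ j = 1 ∨ 2 ≤ j by omega) with rfl | rfl | hj2
          · simp [z]
          · rw [q1, h1]
          · rcases le_or_gt j N with hjN | hjN
            · obtain ⟨k, hk, hk1, hk2⟩ := exists_index (by omega) hj2 (hjN.trans hN.le)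
              rw [hH.long_run_eq q1 qA hk hk1 hk2, pin k j hk hk1 hk2]
            · rw [pin2 j hjN hj]
              have h4 := (hH.long_run q1 qA b).2 le_rfl
              have h5 := (hH.long_run q1 qA b).1
              rw [← hN] at h5
              rw [show (b + 1) * A + 2 = N + 1 by rw [hN]] at h4
              have h6 := hH.short (N + A + N)
              have := hH.mono (show N + A + (N + 1) ≤ N + A + j by omega)
              have := hH.mono (show N + A + j ≤ N + A + N + A by omega)
              omega
        · intro j hj hj'
          rcases (show j = 1 ∨ 2 ≤ j by omega) with rfl | hj2
          · simp [h1]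
          · obtain ⟨k, hk, hk1, hk2⟩ := exists_index (c := b + 1) (A := A) (by omega) hj2
              (hj'.trans NA.ge)
            have hHj : H j = k + 1 := by
              rcases (show k ≤ b ∨ k = b + 1 by omega) with h4 | rfl
              · exact pin k j h4 hk1 hk2
              · rw [pin2 j (by omega) hj']
                push_cast
                ring
            rw [hHj]
            refine ⟨?_, dup k j hk1 hk2⟩
            have h5 := dlo k j hk1
            rcases (show 2 * k ≤ b + 1 ∨ 2 * k = b + 2 ∨ b + 3 ≤ 2 * k by omega) with h6 | h6 | h6
            · have := small k h6
              linarith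
            · have h7 : 2 * (k * A) + 3 = N + A + 2 := by
                rw [show 2 * (k * A) = (2 * k) * A by ring, h6, ← NA]
              have := hH.mono (show N + A + 1 ≤ N + A + 2 by omega)
              rw [h7] at h5
              omega
            · have h7 := (hH.long_run q1 qA (2 * k - b - 3)).2 (by omega)
              have h8 : N + A + ((2 * k - b - 3 + 1) * A + 2) = 2 * (k * A) + 3 := by
                rw [← NA]
                obtain ⟨d, hd⟩ := Nat.exists_eq_add_of_le h6
                rw [show 2 * (k * A) = (2 * k) * A by ring, hd,
                  show b + 3 + d - b - 3 + 1 = d + 1 by omega]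
                ring
              rw [h8, hM] at h7
              push_cast [show b ≤ 2 * k by omega, show 3 ≤ 2 * k - b by omega] at h7
              linarith

end RunBounds

/-! ### Codings of rotations: rounded lines, continued fractions, density. -/

/-- Floor and ceiling, as far as the coding of rotations is concerned. -/
structure IsRounding (f : ℝ → ℤ) : Prop where
  mono : Monotone f
  add_int : ∀ (x : ℝ) (m : ℤ), f (x + m) = f x + m
  lt_one : ∀ x y, |(f x - f y : ℝ) - (x - y)| < 1

theorem isRounding_floor : IsRounding Int.floor where
  mono := Int.floor_mono
  add_int x m := Int.floor_add_intCast x m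
  lt_one x y := by
    have h1 := Int.floor_le x
    have h2 := Int.lt_floor_add_one x
    have h3 := Int.floor_le y
    have h4 := Int.lt_floor_add_one y
    rw [abs_lt]
    constructor <;> linarith

theorem isRounding_ceil : IsRounding Int.ceil where
  mono := Int.ceil_mono
  add_int x m := Int.ceil_add_intCast x m
  lt_one x y := by
    have h1 := Int.le_ceil x
    have h2 := Int.ceil_lt_add_one x
    have h3 := Int.le_ceil y
    have h4 := Int.ceil_lt_add_one y
    rw [abs_lt]
    constructor <;> linarith

/-- A letter is 1 exactly when the orbit lifted to ℝ passes an integer, so the sum of the letters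
telescopes. -/
theorem ones_lowerCoding {α : ℝ} (h0 : 0 < α) (h1 : α < 1) (x : ℝ) (n : ℕ) :
    ones (lowerCoding α x) n = ⌊x + n * α⌋ - ⌊x⌋ := by
  induction n with
  | zero => simp
  | succ n ih =>
    rw [ones_succ, ih]
    have e : x + (n + 1 : ℕ) * α = x + n * α + α := by push_cast; ring
    have h2 := Int.floor_add_fract (x + n * α)
    have h3 := Int.fract_nonneg (x + n * α)
    have h4 := Int.fract_lt_one (x + n * α)
    rw [e]
    unfold lowerCoding
    split_ifs with h
    · have : ⌊x + n * α + α⌋ = ⌊x + n * α⌋ := by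
        rw [Int.floor_eq_iff]
        constructor <;> linarith
      rw [this]; simp
    · have : ⌊x + n * α + α⌋ = ⌊x + n * α⌋ + 1 := by
        rw [Int.floor_eq_iff]
        push_cast
        constructor <;> linarith
      rw [this]; simp; ring

theorem ones_upperCoding {α : ℝ} (h0 : 0 < α) (h1 : α < 1) (x : ℝ) (n : ℕ) :
    ones (upperCoding α x) n = ⌈x + n * α⌉ - ⌈x⌉ := by
  induction n with
  | zero => simp
  | succ n ih =>
    rw [ones_succ, ih]
    have e : x + (n + 1 : ℕ) * α = x + n * α + α := by push_cast; ring
    have h2 := Int.floor_add_fract (x + n * α)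
    have h3 := Int.fract_nonneg (x + n * α)
    have h4 := Int.fract_lt_one (x + n * α)
    rw [e]
    unfold upperCoding
    split_ifs with h
    · have e1 : ⌈x + n * α + α⌉ = ⌊x + n * α⌋ + 1 := by
        rw [Int.ceil_eq_iff]
        push_cast
        constructor <;> linarith
      have e2 : ⌈x + n * α⌉ = ⌊x + n * α⌋ + 1 := by
        rw [Int.ceil_eq_iff]
        push_cast
        constructor <;> linarith
      rw [e1, e2]; simp
    -- Fractional part 0 stands for the point 1 of the circle, which belongs to I₁.
    · rcases h3.eq_or_lt with h5 | h5
      · have e1 : ⌈x + n * α + α⌉ = ⌊x + n * α⌋ + 1 := by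
          rw [Int.ceil_eq_iff]
          push_cast
          constructor <;> linarith
        have e2 : ⌈x + n * α⌉ = ⌊x + n * α⌋ := by
          rw [Int.ceil_eq_iff]
          constructor <;> linarith
        rw [e1, e2]; simp; ring
      · have h6 : 1 - α < Int.fract (x + n * α) := by
          by_contra h7
          exact h ⟨h5, not_lt.1 h7⟩
        have e1 : ⌈x + n * α + α⌉ = ⌊x + n * α⌋ + 2 := by
          rw [Int.ceil_eq_iff]
          push_cast
          constructor <;> linarith
        have e2 : ⌈x + n * α⌉ = ⌊x + n * α⌋ + 1 := by
          rw [Int.ceil_eq_iff]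
          push_cast
          constructor <;> linarith
        rw [e1, e2]; simp; ring

theorem IsSturmianOfSlope.exists_rounding {α : ℝ} {w : InfWord} (h : IsSturmianOfSlope α w) :
    ∃ (f : ℝ → ℤ) (x : ℝ), IsRounding f ∧ ∀ n : ℕ, ones w n = f (x + n * α) - f x := by
  obtain ⟨_, h0, h1, x, rfl | rfl⟩ := h
  · exact ⟨_, x, isRounding_floor, ones_lowerCoding h0 h1 x⟩
  · exact ⟨_, x, isRounding_ceil, ones_upperCoding h0 h1 x⟩

/-- Write 1/α = A + r with B ≤ 1/r < B + 1. The two inequalities are Br ≤ 1 and 1 < (B + 1)r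
multiplied out. They compare α with the window lengths of `RunBounds`. -/
theorem HasExpansion.bounds {α : ℝ} {A B : ℕ} (h : HasExpansion α A B) :
    (B : ℝ) ≤ (B * A + 1) * α ∧ ((B + 1) * A + 1) * α ≤ B + 1 := by
  obtain ⟨hirr, h0, h1, hA, hB⟩ := h
  have hfr : Int.fract α = α := Int.fract_eq_self.2 ⟨h0.le, h1⟩
  have hne : Int.fract α ≠ 0 := by rw [hfr]; exact h0.ne'
  have hirr' : Irrational α⁻¹ := hirr.inv
  have hne' : Int.fract α⁻¹ ≠ 0 := by
    intro h
    have h2 := Int.floor_add_fract α⁻¹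
    rw [h, add_zero] at h2
    exact hirr' ⟨⌊α⁻¹⌋, by push_cast; exact h2⟩
  have e0 : (GenContFract.of α).s.get? 0 = some ⟨1, ⌊α⁻¹⌋⟩ := by
    have := GenContFract.of_s_head hne
    rwa [hfr] at this
  have e1 : (GenContFract.of α).s.get? 1 = some ⟨1, ⌊(Int.fract α⁻¹)⁻¹⌋⟩ := by
    rw [GenContFract.of_s_succ, hfr]
    exact GenContFract.of_s_head hne'
  simp only [GenContFract.partDens, Stream'.Seq.map_get?, e0, e1, Option.map_some,
    Option.some.injEq] at hA hB
  have a1 : (⌊α⁻¹⌋ : ℝ) + Int.fract α⁻¹ = α⁻¹ := Int.floor_add_fract α⁻¹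
  have r0 : 0 < Int.fract α⁻¹ := lt_of_le_of_ne (Int.fract_nonneg _) hne'.symm
  set r := Int.fract α⁻¹ with hr
  have b1 := Int.floor_le r⁻¹
  have b2 := Int.lt_floor_add_one r⁻¹
  rw [hA] at a1
  rw [hB] at b1 b2
  have c1 : (B : ℝ) * r ≤ 1 := by
    have := mul_le_mul_of_nonneg_right b1 r0.le
    rwa [inv_mul_cancel₀ r0.ne'] at this
  have c2 : 1 < ((B : ℝ) + 1) * r := by
    have := mul_lt_mul_of_pos_right b2 r0
    rwa [inv_mul_cancel₀ r0.ne'] at this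
  have c3 : ((A : ℝ) + r) * α = 1 := by rw [a1, inv_mul_cancel₀ h0.ne']
  constructor
  · nlinarith
  · nlinarith

/-- A step of irrational nonzero length smaller than `δ` hits each interval of length `δ`. -/
theorem exists_hit {θ δ y u : ℝ} (h0 : θ ≠ 0) (h1 : |θ| < δ) :
    ∃ (s : ℕ) (N : ℤ), u + N < y + s * θ ∧ y + s * θ < u + N + δ := by
  rcases lt_or_gt_of_ne h0 with h | h
  · rw [abs_of_neg h] at h1
    obtain ⟨N, hN⟩ := exists_int_lt (y - u - δ)
    have p : 0 ≤ (y - (u + N + δ)) / (-θ) := by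
      apply div_nonneg <;> linarith
    have f1 := Nat.floor_le p
    have f2 := Nat.lt_floor_add_one ((y - (u + N + δ)) / (-θ))
    rw [le_div_iff₀ (by linarith)] at f1
    rw [div_lt_iff₀ (by linarith)] at f2
    refine ⟨⌊(y - (u + N + δ)) / (-θ)⌋₊ + 1, N, ?_, ?_⟩ <;> push_cast <;> linarith
  · rw [abs_of_pos h] at h1
    obtain ⟨N, hN⟩ := exists_int_gt (y - u)
    have p : 0 ≤ (u + N - y) / θ := by
      apply div_nonneg <;> linarith
    have f1 := Nat.floor_le p
    have f2 := Nat.lt_floor_add_one ((u + N - y) / θ)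
    rw [le_div_iff₀ h] at f1
    rw [div_lt_iff₀ h] at f2
    refine ⟨⌊(u + N - y) / θ⌋₊ + 1, N, ?_, ?_⟩ <;> push_cast <;> linarith

/-- Dirichlet approximation, with irrationality excluding 0. It supplies the small step for
`exists_hit`. -/
theorem exists_mul_near_int {γ δ : ℝ} (hγ : Irrational γ) (hδ : 0 < δ) :
    ∃ (k : ℕ) (m : ℤ), k * γ - m ≠ 0 ∧ |k * γ - m| < δ := by
  obtain ⟨n, hn⟩ := exists_nat_one_div_lt hδ
  obtain ⟨j, k, hk, -, h⟩ := Real.exists_int_int_abs_mul_sub_le γ (Nat.succ_pos n)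
  lift k to ℕ using hk.le
  refine ⟨k, j, ?_, ?_⟩
  · intro h0
    have h1 : Irrational ((k : ℝ) * γ) := by
      refine Irrational.natCast_mul hγ ?_
      rintro rfl
      simp at hk
    exact h1 ⟨j, by push_cast; linarith⟩
  · refine lt_of_le_of_lt ?_ hn
    push_cast at h
    refine h.trans ?_
    apply one_div_le_one_div_of_le
    · positivity
    · linarith

/-- The letters of a Sturmian word along an arithmetic progression are not constant. -/
theorem not_isSturmian_of_constant_progression {w : InfWord} {c d : ℕ} (hd : d ≠ 0) {x : Fin 2}
    (h : ∀ s, w (c + d * s) = x) : ¬ IsSturmian w := by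
  rintro ⟨α, hα, h0, h1, y, hw⟩
  have key : ∀ u δ : ℝ, 0 < δ → ∃ (s : ℕ) (N : ℤ), u + N < y + (c + d * s : ℕ) * α ∧
      y + (c + d * s : ℕ) * α < u + N + δ := by
    intro u δ hδ
    obtain ⟨k, m, hkm, hkm'⟩ := exists_mul_near_int (hα.natCast_mul hd) hδ
    obtain ⟨s, N, hs, hs'⟩ := exists_hit (y := y + c * α) (u := u) hkm hkm'
    refine ⟨k * s, N + s * m, ?_, ?_⟩ <;> push_cast <;> linarith
  -- The progression visits the interiors of both coding intervals; interiors make the endpoint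
  -- convention irrelevant.
  obtain ⟨s, N, hs, hs'⟩ := key 0 (1 - α) (by linarith)
  obtain ⟨t, M, ht, ht'⟩ := key (1 - α) α h0
  have fs : Int.fract (y + (c + d * s : ℕ) * α) = y + (c + d * s : ℕ) * α - N := by
    rw [Int.fract_eq_iff]
    exact ⟨by linarith, by linarith, N, by ring⟩
  have ft : Int.fract (y + (c + d * t : ℕ) * α) = y + (c + d * t : ℕ) * α - M := by
    rw [Int.fract_eq_iff]
    exact ⟨by linarith, by linarith, M, by ring⟩
  have hst : w (c + d * s) = w (c + d * t) := (h s).trans (h t).symm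
  rcases hw with rfl | rfl
  · unfold lowerCoding at hst
    rw [if_pos (by rw [fs]; linarith), if_neg (by rw [ft]; linarith)] at hst
    exact absurd hst (by decide)
  · unfold upperCoding at hst
    rw [if_pos (by rw [fs]; constructor <;> linarith),
      if_neg (by rw [ft]; intro h; linarith [h.2])] at hst
    exact absurd hst (by decide)

/-! ### Squares at every position. -/

theorem RunBounds.shift {A b : ℕ} {w : InfWord} (h : RunBounds A b (ones w)) (i : ℕ) :
    RunBounds A b (ones (shift w i)) where
  zero := by simp
  step := ones_step _
  short n := by
    have := h.short (i + n)
    simp only [ones_shift, ← add_assoc] at *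
    linarith
  upper n := by
    have := h.upper (i + n)
    simp only [ones_shift, ← add_assoc] at *
    linarith
  lower n := by
    have := h.lower (i + n)
    simp only [ones_shift, ← add_assoc] at *
    linarith

theorem RunBounds.of_mem_subshiftOf {A b : ℕ} {v w : InfWord} (h : RunBounds A b (ones w))
    (hv : v ∈ subshiftOf w) : RunBounds A b (ones v) := by
  have key : ∀ n d, ∃ i, ones v (n + d) - ones v n = ones w (i + d) - ones w i := by
    intro n d
    obtain ⟨i, hi⟩ := mem_subshiftOf_iff.1 hv (n + d)
    have h1 := ones_congr hi n (by omega)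
    have h2 := ones_congr hi (n + d) le_rfl
    exact ⟨i + n, by rw [h1, h2, ← add_assoc]; ring⟩
  refine ⟨by simp, ones_step v, fun n => ?_, fun n => ?_, fun n => ?_⟩
  · obtain ⟨i, hi⟩ := key n A
    have := h.short i
    linarith
  · obtain ⟨i, hi⟩ := key n ((b + 2) * A + 1)
    have := h.upper i
    linarith
  · obtain ⟨i, hi⟩ := key n ((b + 1) * A + 1)
    have := h.lower i
    linarith

theorem factorAt_add (w : InfWord) (i m n : ℕ) :
    factorAt w i (m + n) = factorAt w i m ++ factorAt w (i + m) n := by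
  refine List.ext_getElem (by simp [factorAt]) ?_
  intro k h1 h2
  rcases lt_or_ge k m with h | h
  · rw [List.getElem_append_left (by simpa [factorAt] using h)]
    simp [factorAt]
  · rw [List.getElem_append_right (by simpa [factorAt] using h)]
    simp only [factorAt, List.getElem_map, List.getElem_range, List.length_map, List.length_range]
    congr 1
    omega

theorem factorAt_prefix (w : InfWord) (i : ℕ) {m n : ℕ} (h : m ≤ n) :
    factorAt w i m <+: factorAt w i n := by
  obtain ⟨d, rfl⟩ := Nat.exists_eq_add_of_le h
  exact ⟨_, (factorAt_add w i m d).symm⟩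

/-- At each position, a square with a short half starts, and this half satisfies the doubling
inequalities. -/
theorem RunBounds.exists_square {A b : ℕ} {w : InfWord} (h : RunBounds A b (ones w))
    (hA : 2 ≤ A) (i : ℕ) :
    ∃ l, 1 ≤ l ∧ l ≤ (b + 2) * A + 1 ∧ factorAt w (i + l) l = factorAt w i l ∧
      ∀ j, 1 ≤ j → j ≤ l →
        2 * (ones w (i + j) - ones w i) - 1 ≤ ones w (i + (2 * j - 1)) - ones w i ∧
        ones w (i + (2 * j - 1)) - ones w i ≤ 2 * (ones w (i + j) - ones w i) := by
  obtain ⟨l, h1, h2, h3, h4⟩ := (h.shift i).exists_root hA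
  refine ⟨l, h1, h2, factorAt_eq_iff.2 fun s hs => letter_eq_of_ones ?_, ?_⟩
  · have e1 := h3 s (by omega)
    have e2 := h3 (s + 1) (by omega)
    simp only [ones_shift] at e1 e2
    simp only [← add_assoc] at e1 e2 ⊢
    linarith
  · intro j hj hj'
    simpa only [ones_shift] using h4 j hj hj'

/-- Otherwise the square of length 2l would be a proper prefix of `s`. -/
theorem length_le_of_isMinimalSquare {w : InfWord} {i l : ℕ} (hl : 1 ≤ l)
    (h : factorAt w (i + l) l = factorAt w i l) {s : Word} (hs : IsMinimalSquare s)
    (hsw : s = factorAt w i s.length) : s.length ≤ 2 * l := by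
  by_contra! hlt
  have h1 : IsSquareWord (factorAt w i (2 * l)) := by
    refine ⟨factorAt w i l, ?_, ?_⟩
    · intro h0
      have := congrArg List.length h0
      rw [length_factorAt, List.length_nil] at this
      omega
    · rw [two_mul, factorAt_add, h]
  have h2 := hs.2 (factorAt w i (2 * l)) (by rw [hsw]; exact factorAt_prefix w i hlt.le) h1
  have := congrArg List.length h2
  rw [length_factorAt] at this
  omega

/-- The shortest square starting at the position is minimal. -/
theorem exists_isMinimalSquare {w : InfWord} {i : ℕ} (h : ∃ n, IsSquareWord (factorAt w i n)) :
    ∃ l, 1 ≤ l ∧ IsMinimalSquare (factorAt w i l ++ factorAt w i l) ∧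
      factorAt w (i + l) l = factorAt w i l := by
  classical
  obtain ⟨u, hu, hn⟩ := Nat.find_spec h
  have hlen := congrArg List.length hn
  rw [length_factorAt, List.length_append] at hlen
  have hmin : ∀ t, t <+: factorAt w i (Nat.find h) → IsSquareWord t →
      t = factorAt w i (Nat.find h) := by
    intro t ht hsq
    have h1 : t = factorAt w i t.length := by
      have h2 := factorAt_prefix w i (by simpa [length_factorAt] using ht.length_le :
        t.length ≤ Nat.find h)
      exact (List.prefix_of_prefix_length_le ht h2 (by rw [length_factorAt])).eq_of_length
        (by rw [length_factorAt])
    have h3 := Nat.find_min' h (m := t.length) (h1 ▸ hsq)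
    exact ht.eq_of_length (le_antisymm ht.length_le (by rwa [length_factorAt]))
  rw [hlen, factorAt_add] at hn
  obtain ⟨e1, e2⟩ := List.append_inj hn (by rw [length_factorAt])
  refine ⟨u.length, List.length_pos_iff.2 hu, ?_, by rw [e1, e2]⟩
  have e3 : factorAt w i u.length ++ factorAt w i u.length = factorAt w i (Nat.find h) := by
    rw [hlen, factorAt_add, e1, e2]
  rw [e3]
  exact ⟨Nat.find_spec h, hmin⟩

theorem RunBounds.isSquareful {A b : ℕ} {w : InfWord} (h : RunBounds A b (ones w))
    (hA : 2 ≤ A) : IsSquareful w := by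
  constructor
  · intro i
    obtain ⟨l, h1, -, h3, -⟩ := h.exists_square hA i
    refine ⟨l + l, factorAt w i l, ?_, ?_⟩
    · intro h0
      have := congrArg List.length h0
      rw [length_factorAt, List.length_nil] at this
      omega
    · rw [factorAt_add, h3]
  · refine (List.finite_length_le (Fin 2) (2 * ((b + 2) * A + 1))).subset ?_
    rintro s ⟨⟨i, n, hs⟩, hmin⟩
    obtain ⟨l, h1, h2, h3, -⟩ := h.exists_square hA i
    have h4 : s = factorAt w i s.length := by rw [hs, length_factorAt]
    have := length_le_of_isMinimalSquare h1 h3 hmin h4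
    change s.length ≤ _
    omega

/-! ### Infinite products and square roots -/

theorem flatMap_range_succ (X : ℕ → Word) (n : ℕ) :
    (List.range (n + 1)).flatMap X = (List.range n).flatMap X ++ X n := by
  rw [List.range_succ, List.flatMap_append, List.flatMap_singleton]

theorem isInfProduct_iff {X : ℕ → Word} {w : InfWord} :
    IsInfProduct X w ↔
      ∀ n, factorAt w ((List.range n).flatMap X).length (X n).length = X n := by
  constructor
  · intro h n
    have h1 := h (n + 1)
    unfold IsPrefixOf at h1
    rw [flatMap_range_succ, List.length_append, factorAt_add] at h1
    simpa using (List.append_inj h1 (by rw [length_factorAt])).2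
  · intro h n
    induction n with
    | zero => simp [IsPrefixOf, factorAt]
    | succ n ih =>
      unfold IsPrefixOf at *
      rw [flatMap_range_succ, List.length_append, factorAt_add, ih, zero_add, h n]

theorem le_length_flatMap_range {X : ℕ → Word} (hX : ∀ i, X i ≠ []) (n : ℕ) :
    n ≤ ((List.range n).flatMap X).length := by
  induction n with
  | zero => simp
  | succ n ih =>
    have := List.length_pos_iff.2 (hX n)
    rw [flatMap_range_succ, List.length_append]
    omega

theorem flatMap_range_prefix (X : ℕ → Word) {m n : ℕ} (h : m ≤ n) :
    (List.range m).flatMap X <+: (List.range n).flatMap X := by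
  induction n, h using Nat.le_induction with
  | base => exact List.prefix_rfl
  | succ n _ ih =>
    rw [flatMap_range_succ]
    exact ih.trans (List.prefix_append _ _)

theorem exists_isInfProduct {X : ℕ → Word} (hX : ∀ i, X i ≠ []) : ∃ v, IsInfProduct X v := by
  refine ⟨fun n => ((List.range (n + 1)).flatMap X).getD n 0, fun n => isPrefixOf_iff.2 ?_⟩
  intro s hs
  have h1 : s < ((List.range (s + 1)).flatMap X).length := le_length_flatMap_range hX (s + 1)
  rw [List.getD_eq_getElem _ _ h1]
  rcases le_total n (s + 1) with h | h
  · exact ((flatMap_range_prefix X h).getElem hs).symm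
  · exact (flatMap_range_prefix X h).getElem h1

theorem length_flatMap_square (X : ℕ → Word) (n : ℕ) :
    ((List.range n).flatMap fun i => X i ++ X i).length =
      2 * ((List.range n).flatMap X).length := by
  induction n with
  | zero => simp
  | succ n ih => rw [flatMap_range_succ, flatMap_range_succ]; simp [ih]; ring

theorem exists_isSquareRoot {w : InfWord} (h : ∀ i, ∃ n, IsSquareWord (factorAt w i n)) :
    ∃ v, IsSquareRoot v w := by
  choose r hr1 hr2 hr3 using fun i => exists_isMinimalSquare (h i)
  -- `pos n` is the length of the first `n` roots; the next square starts at twice this position.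
  let pos : ℕ → ℕ := fun n => Nat.rec 0 (fun _ p => p + r (2 * p)) n
  let X : ℕ → Word := fun n => factorAt w (2 * pos n) (r (2 * pos n))
  have hX : ∀ n, X n ≠ [] := fun n h0 => by
    have := congrArg List.length h0
    rw [length_factorAt, List.length_nil] at this
    have := hr1 (2 * pos n)
    omega
  have hpos : ∀ n, ((List.range n).flatMap X).length = pos n := by
    intro n
    induction n with
    | zero => rfl
    | succ n ih =>
      rw [flatMap_range_succ, List.length_append, ih, length_factorAt]
  obtain ⟨v, hv⟩ := exists_isInfProduct hX
  refine ⟨v, X, fun i => hr2 _, isInfProduct_iff.2 fun n => ?_, hv⟩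
  rw [length_flatMap_square, hpos, List.length_append, length_factorAt, factorAt_add, hr3]

theorem ones_of_factorAt_eq {u w : InfWord} {i j n : ℕ} (h : factorAt u i n = factorAt w j n) :
    ∀ s ≤ n, ones u (i + s) - ones u i = ones w (j + s) - ones w j := by
  intro s hs
  rw [← ones_shift]
  exact ones_congr (factorAt_eq_iff.1 h) s hs

/-- The counts of a square root are determined by the counts of the word. -/
theorem IsSquareRoot.ones_bounds {A b : ℕ} {v w : InfWord} (hvw : IsSquareRoot v w)
    (h : RunBounds A b (ones w)) (hA : 2 ≤ A) (j : ℕ) (hj : 1 ≤ j) :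
    2 * ones v j - 1 ≤ ones w (2 * j - 1) ∧ ones w (2 * j - 1) ≤ 2 * ones v j := by
  obtain ⟨X, hX, hw, hv⟩ := hvw
  rw [isInfProduct_iff] at hw hv
  have hne : ∀ i, X i ≠ [] := fun i h0 => by
    obtain ⟨u, hu, hu'⟩ := (hX i).1
    simp [h0] at hu'
    exact hu hu'
  let p : ℕ → ℕ := fun n => ((List.range n).flatMap X).length
  have hp : ∀ n, p (n + 1) = p n + (X n).length := fun n => by
    simp only [p, flatMap_range_succ, List.length_append]
  have hw1 : ∀ n, factorAt w (2 * p n) (X n).length = X n ∧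
      factorAt w (2 * p n + (X n).length) (X n).length = X n := fun n => by
    have h1 := hw n
    rw [length_flatMap_square, List.length_append, factorAt_add] at h1
    exact List.append_inj h1 (by rw [length_factorAt])
  have first : ∀ n, ∀ s ≤ (X n).length,
      ones w (2 * p n + s) - ones w (2 * p n) = ones v (p n + s) - ones v (p n) := fun n =>
    ones_of_factorAt_eq ((hw1 n).1.trans (hv n).symm)
  have double : ∀ n, ones w (2 * p n) = 2 * ones v (p n) := by
    intro n
    induction n with
    | zero => simp [p]
    | succ n ih =>
      have h1 := first n _ le_rfl
      have h2 := ones_of_factorAt_eq ((hw1 n).2.trans (hv n).symm) _ le_rfl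
      rw [hp, show 2 * (p n + (X n).length) = 2 * p n + (X n).length + (X n).length by ring]
      linarith
  obtain ⟨n, hn1, hn2⟩ : ∃ n, p n < j ∧ j ≤ p (n + 1) := by
    classical
    have hex : ∃ n, j ≤ p n := ⟨j, le_length_flatMap_range hne j⟩
    obtain ⟨n, hn⟩ : ∃ n, Nat.find hex = n + 1 := by
      refine Nat.exists_eq_succ_of_ne_zero fun h0 => ?_
      have := Nat.find_spec hex
      rw [h0] at this
      have h00 : p 0 = 0 := rfl
      omega
    exact ⟨n, not_le.1 (Nat.find_min hex (by omega)), hn ▸ Nat.find_spec hex⟩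
  rw [hp] at hn2
  obtain ⟨d, rfl⟩ := Nat.exists_eq_add_of_le hn1.le
  obtain ⟨l, hl1, -, hl3, hl4⟩ := h.exists_square hA (2 * p n)
  -- The minimal square is no longer than the short square found here, so the doubling inequalities
  -- cover the whole of `X n`.
  have hle := length_le_of_isMinimalSquare hl1 hl3 (hX n)
    (by rw [List.length_append, factorAt_add, (hw1 n).1, (hw1 n).2])
  rw [List.length_append] at hle
  have h5 := hl4 d (by omega) (by omega)
  have h6 := first n d (by omega)
  rw [show 2 * p n + (2 * d - 1) = 2 * (p n + d) - 1 by omega] at h5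
  have h7 := double n
  constructor <;> linarith [h5.1, h5.2]

theorem eq_of_ones_eq {u v : InfWord} (h : ∀ j, 1 ≤ j → ones u j = ones v j) : u = v := by
  have h' : ∀ j, ones u j = ones v j := fun j => by
    rcases Nat.eq_zero_or_pos j with rfl | hj
    · simp
    · exact h j hj
  funext n
  exact letter_eq_of_ones (by rw [h', h'])

theorem RunBounds.existsUnique_isSquareRoot {A b : ℕ} {w : InfWord}
    (h : RunBounds A b (ones w)) (hA : 2 ≤ A) : ∃! v, IsSquareRoot v w := by
  obtain ⟨v, hv⟩ := exists_isSquareRoot (h.isSquareful hA).1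
  refine ⟨v, hv, fun u hu => eq_of_ones_eq fun j hj => ?_⟩
  -- Both counts equal ⌈`ones w (2 * j - 1)` / 2⌉.
  have := hv.ones_bounds h hA j hj
  have := hu.ones_bounds h hA j hj
  omega

/-! ### Words along a line of rational slope, and their square roots. -/

/-- A word that is a product of blocks of length `q` with `h` letters `1` each, whose counts are
those of the line of slope `h / q`; the `k`-th block begins with the letter `c k`, which is
the only freedom. -/
structure IsBlockWord (q h : ℕ) (c : ℕ → ℤ) (w : InfWord) : Prop where
  coprime : Nat.Coprime q h
  pos : 0 < h
  lt : h < q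
  letter : ∀ k, c k = 0 ∨ c k = 1
  bounds : ∀ n : ℕ, ((n : ℤ) - 1) * h ≤ q * ones w n ∧ q * ones w n ≤ ((n : ℤ) - 1) * h + q
  block : ∀ k, ones w (k * q + 1) = k * h + c k

namespace IsBlockWord

variable {q h : ℕ} {c : ℕ → ℤ} {w : InfWord}

/-- A count touching one of its bounds makes q divide (n - 1)h, and coprimality removes h. -/
theorem dvd_of_eq (hw : IsBlockWord q h c w) {n : ℕ}
    (hn : q * ones w n = ((n : ℤ) - 1) * h ∨ q * ones w n = ((n : ℤ) - 1) * h + q) :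
    (q : ℤ) ∣ (n : ℤ) - 1 := by
  have hco : IsCoprime (q : ℤ) (h : ℤ) := Nat.isCoprime_iff_coprime.2 hw.coprime
  refine hco.dvd_of_dvd_mul_right ?_
  rcases hn with hn | hn
  · exact ⟨_, hn.symm⟩
  · exact ⟨ones w n - 1, by rw [mul_sub, hn]; ring⟩

theorem exists_index (hw : IsBlockWord q h c w) {n : ℕ} (hn : (q : ℤ) ∣ (n : ℤ) - 1) :
    ∃ k, n = k * q + 1 := by
  have h1 := hw.pos
  have h2 := hw.lt
  rcases n with _ | n
  · have h3 : (q : ℤ) ∣ 1 := by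
      have := hn.neg_right
      simpa using this
    have := Int.le_of_dvd one_pos h3
    omega
  · push_cast at hn
    rw [add_sub_cancel_right, Int.natCast_dvd_natCast] at hn
    obtain ⟨k, rfl⟩ := hn
    exact ⟨k, by ring⟩

theorem strict (hw : IsBlockWord q h c w) {n : ℕ} (hn : ¬ ∃ k, n = k * q + 1) :
    ((n : ℤ) - 1) * h < q * ones w n ∧ q * ones w n < ((n : ℤ) - 1) * h + q := by
  obtain ⟨h1, h2⟩ := hw.bounds n
  exact ⟨lt_of_le_of_ne h1 fun e => hn (hw.exists_index (hw.dvd_of_eq (Or.inl e.symm))),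
    lt_of_le_of_ne h2 fun e => hn (hw.exists_index (hw.dvd_of_eq (Or.inr e)))⟩

/-- Factors shorter than the blocks are balanced around the slope. -/
theorem window (hw : IsBlockWord q h c w) {d : ℕ} (hd : 0 < d) (hdq : d < q) (n : ℕ) :
    (d : ℤ) * h - q < q * (ones w (n + d) - ones w n) ∧
      q * (ones w (n + d) - ones w n) < d * h + q := by
  have h1 := hw.bounds n
  have h2 := hw.bounds (n + d)
  have key : ¬ ((q : ℤ) ∣ (n : ℤ) - 1 ∧ (q : ℤ) ∣ ((n + d : ℕ) : ℤ) - 1) := by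
    rintro ⟨h3, h4⟩
    have h5 := dvd_sub h4 h3
    rw [show ((n + d : ℕ) : ℤ) - 1 - ((n : ℤ) - 1) = d by push_cast; ring] at h5
    have := Int.le_of_dvd (by omega) h5
    omega
  constructor
  · refine lt_of_le_of_ne ?_ fun e => key ⟨hw.dvd_of_eq (Or.inr ?_), hw.dvd_of_eq (Or.inl ?_)⟩
    all_goals
      push_cast at *
      linarith
  · refine lt_of_le_of_ne ?_ fun e => key ⟨hw.dvd_of_eq (Or.inl ?_), hw.dvd_of_eq (Or.inr ?_)⟩
    all_goals
      push_cast at *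
      linarith

theorem runBounds (hw : IsBlockWord q h c w) {A b : ℕ} (hA : 1 ≤ A)
    (hq : (b + 2) * A + 1 < q) (h1 : ((b + 2) * A + 1) * h ≤ q * (b + 2))
    (h2 : q * (b + 1) ≤ ((b + 1) * A + 1) * h) : RunBounds A b (ones w) := by
  have q0 : (0 : ℤ) < q := by omega
  have e1 : (b + 2) * A = (b + 1) * A + A := by ring
  have hAh : A * h ≤ q := by
    have : (b + 2) * (A * h) ≤ (b + 2) * q := by nlinarith
    exact Nat.le_of_mul_le_mul_left this (by omega)
  zify at hAh h1 h2
  refine ⟨by simp, ones_step w, fun n => ?_, fun n => ?_, fun n => ?_⟩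
  · have := (hw.window (by omega) (show A < q by omega) n).2
    have h3 : q * (ones w (n + A) - ones w n) < q * (2 : ℤ) := by linarith
    have := lt_of_mul_lt_mul_left h3 q0.le
    omega
  · have := (hw.window (by omega) hq n).2
    have h3 : q * (ones w (n + ((b + 2) * A + 1)) - ones w n) < q * (b + 3 : ℤ) := by
      push_cast at *
      linarith
    have := lt_of_mul_lt_mul_left h3 q0.le
    omega
  · have := (hw.window (by omega) (show (b + 1) * A + 1 < q by omega) n).1
    have h3 : q * (b : ℤ) < q * (ones w (n + ((b + 1) * A + 1)) - ones w n) := by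
      push_cast at *
      linarith
    have := lt_of_mul_lt_mul_left h3 q0.le
    omega

theorem exists_residue (hw : IsBlockWord q h c w) (z : ℤ) :
    ∃ (i : ℕ) (y : ℤ), i * h = q * y + z := by
  have hco : IsCoprime (q : ℤ) (h : ℤ) := Nat.isCoprime_iff_coprime.2 hw.coprime
  obtain ⟨s, t, hst⟩ := hco
  have q0 : (0 : ℤ) < q := by have := hw.lt; omega
  refine ⟨(t * z % q).toNat, -(s * z) - t * z / q * h, ?_⟩
  rw [Int.toNat_of_nonneg (Int.emod_nonneg _ q0.ne')]
  have h1 : t * z % q = t * z - q * (t * z / q) := by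
    have := Int.emod_add_mul_ediv (t * z) q
    linarith
  rw [h1]
  linear_combination z * hst

theorem eq_of_near {x y : ℤ} {q : ℕ} (h1 : q * x < q * y + q) (h2 : q * y < q * x + q) :
    x = y := by
  have q0 : (0 : ℤ) < q := by linarith
  have h5 : (q : ℤ) * x < q * (y + 1) := by linarith
  have h6 : (q : ℤ) * y < q * (x + 1) := by linarith
  have := lt_of_mul_lt_mul_left h5 q0.le
  have := lt_of_mul_lt_mul_left h6 q0.le
  omega

theorem prefix_of_ones {v w : InfWord} {n i : ℕ} {y : ℤ}
    (h : ∀ j ≤ n, ones w (i + j) - y = ones v j) : ∀ s < n, v s = w (i + s) := by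
  intro s hs
  refine letter_eq_of_ones ?_
  have h1 := h s hs.le
  have h2 := h (s + 1) hs
  rw [← add_assoc] at h2
  linarith

/-- If the intercept of a prefix of `w` has the wrong parity, then a square root of it is a factor
of the periodic word of the same slope. -/
theorem root_prefix_of_odd {v p : InfWord} {e : ℤ} (hw : IsBlockWord q h c w)
    (hp : IsBlockWord q h (fun _ => e) p) {i n : ℕ} {B : ℤ}
    (hB : (i : ℤ) * h - q * ones w i = 2 * B + 1)
    (hv : ∀ j, 1 ≤ j → j ≤ n → 2 * ones v j - 1 ≤ ones w (i + (2 * j - 1)) - ones w i ∧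
      ones w (i + (2 * j - 1)) - ones w i ≤ 2 * ones v j) :
    ∃ i', ∀ s < n, v s = p (i' + s) := by
  have q0 : (0 : ℤ) < h := by exact_mod_cast hw.pos
  have q1 : (h : ℤ) < q := by exact_mod_cast hw.lt
  have hi := hw.bounds i
  -- The shift by `e` puts the ambiguous points of `p` strictly inside the interval of `strict1` for
  -- either value of `e`. That interval contains only q integers, so it determines the counts.
  obtain ⟨i', y, hy⟩ := hp.exists_residue (B + 1 - e)
  have strict1 : ∀ m : ℕ, B + ((m : ℤ) - 1 - i') * h < q * (ones p m - y) ∧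
      q * (ones p m - y) < B + ((m : ℤ) - 1 - i') * h + q + 1 := by
    intro m
    by_cases hm : ∃ k, m = k * q + 1
    · obtain ⟨k, rfl⟩ := hm
      rw [hp.block k]
      push_cast
      rcases hp.letter 0 with rfl | rfl
      · constructor <;> nlinarith
      · constructor <;> nlinarith
    · obtain ⟨h1, h2⟩ := hp.strict hm
      rcases hp.letter 0 with rfl | rfl
      · constructor <;> nlinarith
      · constructor <;> nlinarith
  refine ⟨i', prefix_of_ones (y := y) fun j hj => ?_⟩
  obtain ⟨s1, s2⟩ := strict1 (i' + j)
  rcases Nat.eq_zero_or_pos j with rfl | hj0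
  · push_cast at s1 s2
    rw [ones_zero]
    have h1 : (i' : ℤ) - 1 - i' = -1 := by ring
    simp only [add_zero, h1, neg_one_mul] at s1 s2 ⊢
    refine eq_of_near (q := q) ?_ ?_ <;> linarith
  · obtain ⟨h1, h2⟩ := hv j hj0 hj
    obtain ⟨b1, b2⟩ := hw.bounds (i + (2 * j - 1))
    push_cast [show 1 ≤ 2 * j by omega] at b1 b2 s1 s2
    have e1 : ((i' : ℤ) + j - 1 - i') * h = j * h - h := by ring
    have e2 : ((i : ℤ) + (2 * j - 1) - 1) * h = i * h + 2 * (j * h) - 2 * h := by ring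
    rw [e1] at s1 s2
    rw [e2] at b1 b2
    have m1 := mul_le_mul_of_nonneg_left h1 (q0.trans q1).le
    have m2 := mul_le_mul_of_nonneg_left h2 (q0.trans q1).le
    have e3 : (q : ℤ) * (2 * ones v j - 1) = 2 * (q * ones v j) - q := by ring
    have e4 : (q : ℤ) * (2 * ones v j) = 2 * (q * ones v j) := by ring
    rw [e3, mul_sub] at m1
    rw [e4, mul_sub] at m2
    refine eq_of_near (q := q) ?_ ?_ <;> omega

/-- Modulo 2 the pairs (i, x) with ih = qx form a line spanned by (q, h), which is nonzero by
coprimality. -/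
theorem exists_even {q h : ℕ} {i x M : ℤ} (hco : Nat.Coprime q h) (hM : Odd M)
    (he : Even (i * h - q * x)) :
    Even i ∧ Even x ∨ Even (i + q * M) ∧ Even (x + h * M) := by
  have hM' : ¬ Even M := Int.not_even_iff_odd.2 hM
  have hqh : ¬ (Even (q : ℤ) ∧ Even (h : ℤ)) := by
    rintro ⟨h1, h2⟩
    rw [Int.even_coe_nat] at h1 h2
    have := Nat.dvd_gcd h1.two_dvd h2.two_dvd
    rw [hco] at this
    omega
  simp only [Int.even_sub, Int.even_add, Int.even_mul] at *
  tauto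

/-- If the intercept of a prefix of `w` has the right parity, then a square root of it is a factor
of `w`. -/
theorem root_prefix_of_even {v : InfWord} (hw : IsBlockWord q h c w)
    (hc : ∀ k, c (2 * k) = c k)
    (hper : ∀ N, ∃ M, Odd M ∧ ∀ k, 1 ≤ k → k ≤ N → c (k + M) = c k) {i n : ℕ} {B : ℤ}
    (hB : (i : ℤ) * h - q * ones w i = 2 * B)
    (hv : ∀ j, 1 ≤ j → j ≤ n → 2 * ones v j - 1 ≤ ones w (i + (2 * j - 1)) - ones w i ∧
      ones w (i + (2 * j - 1)) - ones w i ≤ 2 * ones v j) :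
    ∃ i', ∀ s < n, v s = w (i' + s) := by
  have q0 : (0 : ℤ) < h := by exact_mod_cast hw.pos
  have q1 : (h : ℤ) < q := by exact_mod_cast hw.lt
  have hi := hw.bounds i
  -- The bound i + 2n exceeds every block number met below.
  obtain ⟨M, hM, hMc⟩ := hper (i + 2 * n)
  -- The point (i, `ones w i`) is to be halved. If it is not even, it is first moved by the odd
  -- number M of periods (t = 1). In that case i ≥ 1, which later keeps the exceptional block 0 out.
  obtain ⟨i', y, t, hi', hy, ht⟩ : ∃ (i' : ℕ) (y : ℤ) (t : ℕ), 2 * i' = i + t * M * q ∧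
      2 * y = ones w i + t * M * h ∧ (t = 0 ∨ t = 1 ∧ 1 ≤ i) := by
    by_cases h0 : Even (i : ℤ) ∧ Even (ones w i)
    · obtain ⟨⟨i', h1⟩, y, h2⟩ := h0
      exact ⟨i'.toNat, y, 0, by omega, by rw [h2]; push_cast; ring, Or.inl rfl⟩
    · have hi1 : 1 ≤ i := by
        rcases Nat.eq_zero_or_pos i with rfl | h1
        · simp at h0
        · exact h1
      have hM' : Odd (M : ℤ) := by exact_mod_cast hM
      obtain ⟨⟨i', h1⟩, y, h2⟩ :=
        (exists_even hw.coprime hM' ⟨B, by rw [hB]; ring⟩).resolve_left h0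
      refine ⟨i'.toNat, y, 1, ?_, ?_, Or.inr ⟨rfl, hi1⟩⟩
      · have : 0 ≤ (q : ℤ) * M := by positivity
        zify
        rw [Int.toNat_of_nonneg (by omega)]
        linear_combination -h1
      · push_cast
        linear_combination -h2
  have hyB : (i' : ℤ) * h - q * y = B := by
    zify at hi'
    have : 2 * ((i' : ℤ) * h - q * y) = 2 * B := by
      linear_combination h * hi' - q * hy + hB
    linarith
  refine ⟨i', prefix_of_ones (y := y) fun j hj => ?_⟩
  obtain ⟨s1, s2⟩ := hw.bounds (i' + j)
  push_cast at s1 s2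
  have e0 : ((i' : ℤ) + j - 1) * h = i' * h + j * h - h := by ring
  rw [e0] at s1 s2
  rcases Nat.eq_zero_or_pos j with rfl | hj0
  · rw [ones_zero]
    simp only [add_zero, Nat.cast_zero, zero_mul] at s1 s2 ⊢
    have e5 : (q : ℤ) * (ones w i' - y) = q * ones w i' - q * y := by ring
    refine eq_of_near (q := q) ?_ ?_ <;> rw [e5] <;> linarith
  · obtain ⟨h1, h2⟩ := hv j hj0 hj
    by_cases hk : ∃ k, i' + j = k * q + 1
    · obtain ⟨k, hk⟩ := hk
      -- The start of block k in the root comes from the start of block 2k - tM in `w`;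
      -- self-similarity and the almost-period identify their letters.
      have htM : t * M ≤ 2 * k ∧ c (2 * k - t * M) = c k := by
        rcases ht with rfl | ⟨rfl, hi1⟩
        · simp [hc]
        · have h3 : i + 2 * j - 2 + M * q = 2 * k * q := by
            rw [one_mul] at hi'
            have : 2 * k * q = 2 * (k * q) := by ring
            omega
          have h4 : M * q < 2 * k * q := by omega
          have h5 : M < 2 * k := lt_of_mul_lt_mul_right h4 (Nat.zero_le q)
          have h6 : (2 * k - M) * q = i + 2 * j - 2 := by
            rw [Nat.sub_mul]
            omega
          have h7 : 2 * k - M ≤ (2 * k - M) * q := Nat.le_mul_of_pos_right _ (by omega)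
          rw [one_mul]
          refine ⟨h5.le, ?_⟩
          rw [← hMc (2 * k - M) (by omega) (by omega), Nat.sub_add_cancel h5.le, hc]
      have h3 : i + (2 * j - 1) = (2 * k - t * M) * q + 1 := by
        rw [Nat.sub_mul]
        have : t * M * q ≤ 2 * k * q := Nat.mul_le_mul_right _ htM.1
        have : 2 * k * q = 2 * (k * q) := by ring
        omega
      rw [h3, hw.block, htM.2] at h1 h2
      rw [hk, hw.block]
      have h4 : ((2 * k - t * M : ℕ) : ℤ) * h + c k - ones w i = 2 * (k * h - y) + c k := by
        push_cast [htM.1]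
        linear_combination hy
      rw [h4] at h1 h2
      rcases hw.letter k with h5 | h5 <;> rw [h5] at h1 h2 ⊢ <;> linarith
    · obtain ⟨s1, s2⟩ := hw.strict hk
      obtain ⟨b1, b2⟩ := hw.bounds (i + (2 * j - 1))
      push_cast [show 1 ≤ 2 * j by omega] at b1 b2 s1 s2
      have e2 : ((i : ℤ) + (2 * j - 1) - 1) * h = i * h + 2 * (j * h) - 2 * h := by ring
      rw [e0] at s1 s2
      rw [e2] at b1 b2
      have m1 := mul_le_mul_of_nonneg_left h1 (q0.trans q1).le
      have m2 := mul_le_mul_of_nonneg_left h2 (q0.trans q1).le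
      have e3 : (q : ℤ) * (2 * ones v j - 1) = 2 * (q * ones v j) - q := by ring
      have e4 : (q : ℤ) * (2 * ones v j) = 2 * (q * ones v j) := by ring
      have e5 : (q : ℤ) * (ones w (i' + j) - y) = q * ones w (i' + j) - q * y := by ring
      rw [e3, mul_sub] at m1
      rw [e4, mul_sub] at m2
      refine eq_of_near (q := q) ?_ ?_ <;> rw [e5] <;> linarith

/-- The square roots of the words in the subshift of a block word with self-similar choice of
first letters are in this subshift or in the one of the periodic word of the same slope. -/
theorem root_mem {u v p : InfWord} {e : ℤ} {A b : ℕ} (hw : IsBlockWord q h c w)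
    (hp : IsBlockWord q h (fun _ => e) p) (hc : ∀ k, c (2 * k) = c k)
    (hper : ∀ N, ∃ M, Odd M ∧ ∀ k, 1 ≤ k → k ≤ N → c (k + M) = c k)
    (hb : RunBounds A b (ones w)) (hA : 2 ≤ A) (hu : u ∈ subshiftOf w)
    (hvu : IsSquareRoot v u) : v ∈ subshiftOf w ∪ subshiftOf p := by
  refine mem_union_of_prefixes fun n => ?_
  obtain ⟨i, hi⟩ := mem_subshiftOf_iff.1 hu (2 * n)
  have hv : ∀ j, 1 ≤ j → j ≤ n → 2 * ones v j - 1 ≤ ones w (i + (2 * j - 1)) - ones w i ∧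
      ones w (i + (2 * j - 1)) - ones w i ≤ 2 * ones v j := by
    intro j hj hj'
    rw [← ones_congr hi (2 * j - 1) (by omega)]
    exact hvu.ones_bounds (hb.of_mem_subshiftOf hu) hA j hj
  obtain ⟨B, hB | hB⟩ := Int.even_or_odd' ((i : ℤ) * h - q * ones w i)
  · exact Or.inl (hw.root_prefix_of_even hc hper hB hv)
  · exact Or.inr (hw.root_prefix_of_odd hp hB hv)

end IsBlockWord

/-! ### Solutions of the word equation -/

/-- The counts of `1` in the prefixes of `Y` are, up to rounding, twice those in the prefixes of
`X`. -/
structure Doubles (X Y : Word) : Prop where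
  length : Y.length = 2 * X.length
  count : Y.count 1 = 2 * X.count 1
  bounds : ∀ j, 1 ≤ j → j ≤ X.length →
    2 * (X.take j).count 1 ≤ (Y.take (2 * j - 1)).count 1 + 1 ∧
      (Y.take (2 * j - 1)).count 1 ≤ 2 * (X.take j).count 1

theorem Doubles.append {X Y X' Y' : Word} (h : Doubles X Y) (h' : Doubles X' Y') :
    Doubles (X ++ X') (Y ++ Y') := by
  refine ⟨by simp [h.length, h'.length]; ring, by simp [h.count, h'.count]; ring, ?_⟩
  intro j hj hj'
  rw [List.length_append] at hj'
  rcases le_or_gt j X.length with hX | hX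
  · have h1 := h.bounds j hj hX
    have h2 : Y.length = 2 * X.length := h.length
    simpa [List.take_append, show j - X.length = 0 by omega,
      show 2 * j - 1 - Y.length = 0 by omega] using h1
  · have h1 := h'.bounds (j - X.length) (by omega) (by omega)
    have h2 : Y.length = 2 * X.length := h.length
    have h3 : 2 * j - 1 - Y.length = 2 * (j - X.length) - 1 := by omega
    have h4 := h.count
    rw [List.take_append, List.take_append, List.count_append, List.count_append, h3,
      List.take_of_length_le (by omega), List.take_of_length_le (l := Y) (by omega)]
    omega

theorem count_take_oneZeros_append (m n : ℕ) (Y : Word) :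
    ((oneZeros m ++ Y).take n).count 1 =
      if n = 0 then 0 else 1 + (Y.take (n - 1 - m)).count 1 := by
  rcases n with _ | n
  · simp
  · simp [oneZeros, List.take_append, List.take_replicate, List.count_replicate]
    ring

theorem count_take_oneZeros (m n : ℕ) :
    ((oneZeros m).take n).count 1 = if n = 0 then 0 else 1 := by
  simpa using count_take_oneZeros_append m n []

theorem length_oneZeros (m : ℕ) : (oneZeros m).length = m + 1 := by simp [oneZeros]

theorem wordPow_succ (u : Word) (n : ℕ) : wordPow u (n + 1) = u ++ wordPow u n := by
  simp [wordPow, List.replicate_succ]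

theorem length_wordPow (u : Word) (n : ℕ) : (wordPow u n).length = n * u.length := by
  simp [wordPow]

/-- The quotient is the ceiling of n / (a + 1): every block begun contributes its leading 1. -/
theorem count_take_wordPow_oneZeros (a c n : ℕ) :
    ((wordPow (oneZeros a) c).take n).count 1 = min c ((n + a) / (a + 1)) := by
  induction c generalizing n with
  | zero => simp [wordPow]
  | succ c ih =>
    rw [wordPow_succ, count_take_oneZeros_append, ih]
    rcases n with _ | n
    · rw [if_pos rfl, Nat.div_eq_of_lt (by omega), Nat.min_zero]
    · rw [if_neg (by omega)]
      have h1 : (n + 1 + a) / (a + 1) = n / (a + 1) + 1 := by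
        rw [show n + 1 + a = n + (a + 1) by ring, Nat.add_div_right _ (by omega)]
      have h2 : (n + 1 - 1 - a + a) / (a + 1) = n / (a + 1) := by
        rcases le_or_gt a n with h | h
        · congr 1
          omega
        · rw [Nat.div_eq_of_lt (by omega), Nat.div_eq_of_lt (by omega)]
      rw [h1, h2]
      omega

theorem doubles_zero : Doubles [0] ([0] ++ [0]) := by
  refine ⟨rfl, rfl, fun j hj hj' => ?_⟩
  obtain rfl : j = 1 := le_antisymm hj' hj
  decide

theorem doubles_oneZeros (m : ℕ) : Doubles (oneZeros m) (oneZeros m ++ oneZeros m) := by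
  refine ⟨by simp; ring, by simp; ring, fun j hj hj' => ?_⟩
  rw [length_oneZeros] at hj'
  rw [count_take_oneZeros_append, count_take_oneZeros, count_take_oneZeros, if_neg (by omega),
    if_neg (by omega)]
  split_ifs <;> omega

theorem doubles_zero_oneZeros (m : ℕ) :
    Doubles (0 :: oneZeros m) ((0 :: oneZeros m) ++ (0 :: oneZeros m)) := by
  refine ⟨by simp; ring, by simp; ring, fun j hj hj' => ?_⟩
  rw [List.length_cons, length_oneZeros] at hj'
  obtain ⟨i, rfl⟩ : ∃ i, j = i + 1 := ⟨j - 1, by omega⟩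
  rw [show 2 * (i + 1) - 1 = 2 * i + 1 by omega, List.cons_append, List.take_succ_cons,
    List.take_succ_cons, List.count_cons_of_ne (by decide), List.count_cons_of_ne (by decide),
    count_take_oneZeros_append, count_take_oneZeros]
  rcases i with _ | i
  · simp
  · rw [if_neg (by omega), if_neg (by omega)]
    rcases h : 2 * (i + 1) - 1 - m with _ | k
    · simp
    · rw [List.take_succ_cons, List.count_cons_of_ne (by decide), count_take_oneZeros]
      split_ifs <;> omega

theorem doubles_long (a c : ℕ) :
    Doubles (oneZeros (a + 1) ++ wordPow (oneZeros a) c)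
      ((oneZeros (a + 1) ++ wordPow (oneZeros a) c) ++
        (oneZeros (a + 1) ++ wordPow (oneZeros a) c)) := by
  refine ⟨by simp; ring, by simp; ring, fun j hj hj' => ?_⟩
  have hl : (oneZeros (a + 1) ++ wordPow (oneZeros a) c).length = (c + 1) * (a + 1) + 1 := by
    rw [List.length_append, length_wordPow, length_oneZeros, length_oneZeros]
    ring
  rw [hl] at hj'
  have hXX : ∀ X : Word, ∀ n, ((X ++ X).take n).count 1 =
      (X.take n).count 1 + (X.take (n - X.length)).count 1 := fun X n => by
    rw [List.take_append, List.count_append]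
  rw [hXX, hl]
  simp only [count_take_oneZeros_append, count_take_wordPow_oneZeros]
  obtain ⟨A, hA⟩ : ∃ A, a + 1 = A := ⟨_, rfl⟩
  rw [hA] at hj' ⊢
  have hA0 : 0 < A := by omega
  have le_iff : ∀ n t, (n - 1 - A + a) / A ≤ t ↔ n - 1 - A + a < (t + 1) * A :=
    fun n t => by rw [← Nat.div_lt_iff_lt_mul hA0, Nat.lt_succ_iff]
  have ge_iff : ∀ n t, t ≤ (n - 1 - A + a) / A ↔ t * A ≤ n - 1 - A + a :=
    fun n t => by rw [Nat.le_div_iff_mul_le hA0]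
  -- `k` counts the blocks 1 0^a begun in the prefix of length j. Doubling j passes into the second
  -- copy of the word when 2k is large compared with c, and then `d` is the excess there.
  obtain ⟨k, hk⟩ : ∃ k, k = (j - 1 - A + a) / A := ⟨_, rfl⟩
  have k1 := (le_iff j k).1 hk.ge
  have k2 := (ge_iff j k).1 hk.le
  have kc : k ≤ c := by
    rw [hk, le_iff]
    have : (c + 1) * A ≥ A := Nat.le_mul_of_pos_left _ (by omega)
    omega
  have e1 : (k + 1) * A = k * A + A := by ring
  have e2 : (c + 1) * A = c * A + A := by ring
  rw [e1] at k1
  rw [e2] at hj' ⊢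
  rw [← hk, if_neg (by omega), if_neg (by omega), min_eq_right kc]
  constructor
  · rcases le_or_gt (2 * k) c with h | h
    · have h1 : 2 * k ≤ (2 * j - 1 - 1 - A + a) / A := by
        rw [ge_iff, mul_assoc]
        rcases Nat.eq_zero_or_pos k with rfl | hk0
        · simp
        · have : A ≤ k * A := Nat.le_mul_of_pos_left _ hk0
          omega
      generalize (2 * j - 1 - (c * A + A + 1) - 1 - A + a) / A = y
      split_ifs <;> omega
    · obtain ⟨d, hd⟩ := Nat.exists_eq_add_of_lt h
      have e3 : 2 * (k * A) = c * A + d * A + A := by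
        rw [← mul_assoc, hd]; ring
      have hkA : A ≤ k * A := Nat.le_mul_of_pos_left _ (by omega)
      have h1 : c ≤ (2 * j - 1 - 1 - A + a) / A := by
        rw [ge_iff]
        omega
      have h2 : d ≤ (2 * j - 1 - (c * A + A + 1) - 1 - A + a) / A := by
        rw [ge_iff]
        rcases Nat.eq_zero_or_pos d with rfl | hd0
        · simp
        · have : A ≤ d * A := Nat.le_mul_of_pos_left _ hd0
          omega
      rw [if_neg (by omega)]
      omega
  · rcases le_or_gt (2 * j - 1) (c * A + A + 1) with h | h
    · have h1 : (2 * j - 1 - 1 - A + a) / A ≤ 2 * k + 1 := by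
        rw [le_iff, show (2 * k + 1 + 1) * A = 2 * (k * A) + 2 * A by ring]
        omega
      rw [if_pos (by omega)]
      omega
    · have h0 : c ≤ 2 * k := by
        by_contra! h3
        obtain ⟨d, hd⟩ := Nat.exists_eq_add_of_lt h3
        have e3 : c * A = 2 * (k * A) + d * A + A := by
          rw [hd]; ring
        omega
      obtain ⟨d, hd⟩ := Nat.exists_eq_add_of_le h0
      have e3 : 2 * (k * A) = c * A + d * A := by
        rw [← mul_assoc, hd]; ring
      have h1 : (2 * j - 1 - (c * A + A + 1) - 1 - A + a) / A ≤ d := by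
        rw [le_iff, show (d + 1) * A = d * A + A by ring]
        omega
      rw [if_neg (by omega)]
      omega

theorem doubles_of_mem {a b : ℕ} {u : Word} (h : u ∈ minimalSquareRoots a b) :
    Doubles u (u ++ u) := by
  rcases h with rfl | rfl | rfl | rfl | rfl | rfl
  · exact doubles_zero
  · exact doubles_zero_oneZeros _
  · exact doubles_zero_oneZeros _
  · exact doubles_oneZeros _
  · exact doubles_long _ _
  · exact doubles_long _ _

/-- The inequalities hold for each factor and add up along the product. The word equation says that
the product of the squares is `w ++ w`. -/
theorem IsSolution.doubles {a b : ℕ} {w : Word} (h : IsSolution a b w) : Doubles w (w ++ w) := by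
  obtain ⟨-, X, hX, rfl, hw⟩ := h
  rw [← hw]
  clear hw
  induction X with
  | nil => exact ⟨rfl, rfl, fun j hj hj' => absurd (hj.trans hj') (by simp)⟩
  | cons u X ih =>
    rw [List.flatten_cons, List.flatMap_cons]
    exact (doubles_of_mem (hX u (by simp))).append (ih fun v hv => hX v (by simp [hv]))

/-! ### The periodic word S^ω and its line. -/

theorem omegaPow_add_length (S : Word) (n : ℕ) : omegaPow S (n + S.length) = omegaPow S n := by
  simp [omegaPow]

theorem omegaPow_of_lt {S : Word} {n : ℕ} (h : n < S.length) : omegaPow S n = S.getD n 0 := by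
  simp [omegaPow, Nat.mod_eq_of_lt h]

theorem factorAt_omegaPow (S : Word) : factorAt (omegaPow S) 0 S.length = S := by
  refine isPrefixOf_iff.2 fun s hs => ?_
  rw [omegaPow_of_lt hs, List.getD_eq_getElem _ _ hs]

theorem factorAt_add_left_of_periodic {w : InfWord} {d : ℕ} (hw : ∀ n, w (n + d) = w n)
    (i n : ℕ) : factorAt w (i + d) n = factorAt w i n :=
  factorAt_eq_iff.2 fun s _ => by rw [← hw (i + s)]; congr 1; ring

theorem factorAt_omegaPow_square (S : Word) :
    factorAt (omegaPow S) 0 (2 * S.length) = S ++ S := by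
  rw [two_mul, factorAt_add, factorAt_add_left_of_periodic (omegaPow_add_length S),
    factorAt_omegaPow]

theorem count_factorAt (w : InfWord) (i n : ℕ) :
    ((factorAt w i n).count 1 : ℤ) = ones w (i + n) - ones w i := by
  induction n with
  | zero => simp [factorAt]
  | succ n ih =>
    rw [factorAt_add, List.count_append, Nat.cast_add, ih, ← add_assoc, ones_succ]
    have h : ((factorAt w (i + n) 1).count 1 : ℤ) = (w (i + n)).val := by
      simp only [factorAt, List.range_one, List.map_cons, List.map_nil, add_zero]
      generalize w (i + n) = x
      fin_cases x <;> rfl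
    rw [h]
    ring

theorem take_factorAt (w : InfWord) (i : ℕ) {n m : ℕ} (h : n ≤ m) :
    (factorAt w i m).take n = factorAt w i n := by
  obtain ⟨d, rfl⟩ := Nat.exists_eq_add_of_le h
  rw [factorAt_add, List.take_append_of_le_length (by rw [length_factorAt]),
    List.take_of_length_le (by rw [length_factorAt])]

theorem wordPow_factorAt_of_periodic {w : InfWord} {d : ℕ} (hw : ∀ n, w (n + d) = w n) (g : ℕ) :
    factorAt w 0 (g * d) = wordPow (factorAt w 0 d) g := by
  induction g with
  | zero => simp [factorAt, wordPow]
  | succ g ih =>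
    rw [wordPow_succ, ← ih, add_mul, one_mul, add_comm, factorAt_add,
      factorAt_add_left_of_periodic hw]

/-- The number of letters `1` of a finite word. -/
def weight (S : Word) : ℕ := S.count 1

theorem ones_add_of_periodic {w : InfWord} {d : ℕ} (hw : ∀ n, w (n + d) = w n) (n : ℕ) :
    ones w (n + d) = ones w n + ones w d := by
  have := ones_congr (u := w) (w := w) (i := d) (n := n) (fun s _ => by rw [add_comm, hw]) n le_rfl
  rw [add_comm n d]
  linarith

theorem ones_omegaPow_length (S : Word) : ones (omegaPow S) S.length = weight S := by
  have := count_factorAt (omegaPow S) 0 S.length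
  rw [factorAt_omegaPow, ones_zero, zero_add, sub_zero] at this
  exact this.symm

theorem ones_omegaPow_add_mul (S : Word) (n t : ℕ) :
    ones (omegaPow S) (n + t * S.length) = ones (omegaPow S) n + t * weight S := by
  induction t with
  | zero => simp
  | succ t ih =>
    rw [add_mul, one_mul, ← add_assoc, ones_add_of_periodic (omegaPow_add_length S), ih,
      ones_omegaPow_length]
    push_cast
    ring

theorem Doubles.ones_omegaPow {S : Word} (h : Doubles S (S ++ S)) (hS : S ≠ []) (n : ℕ)
    (hn : 1 ≤ n) :
    2 * ones (omegaPow S) n - 1 ≤ ones (omegaPow S) (2 * n - 1) ∧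
      ones (omegaPow S) (2 * n - 1) ≤ 2 * ones (omegaPow S) n := by
  have q0 := List.length_pos_iff.2 hS
  have base : ∀ j, 1 ≤ j → j ≤ S.length →
      2 * ones (omegaPow S) j - 1 ≤ ones (omegaPow S) (2 * j - 1) ∧
      ones (omegaPow S) (2 * j - 1) ≤ 2 * ones (omegaPow S) j := by
    intro j hj hj'
    have h1 := h.bounds j hj hj'
    rw [← factorAt_omegaPow_square, take_factorAt _ _ (by omega)] at h1
    have h2 := take_factorAt (omegaPow S) 0 hj'
    rw [factorAt_omegaPow] at h2
    rw [h2] at h1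
    have h3 := count_factorAt (omegaPow S) 0 j
    have h4 := count_factorAt (omegaPow S) 0 (2 * j - 1)
    rw [ones_zero, zero_add, sub_zero] at h3 h4
    omega
  have h1 := base ((n - 1) % S.length + 1) (by omega) (Nat.mod_lt _ q0)
  have h2 := Nat.mod_add_div' (n - 1) S.length
  have h3 := ones_omegaPow_add_mul S ((n - 1) % S.length + 1) ((n - 1) / S.length)
  have h4 := ones_omegaPow_add_mul S (2 * ((n - 1) % S.length + 1) - 1) (2 * ((n - 1) / S.length))
  rw [show (n - 1) % S.length + 1 + (n - 1) / S.length * S.length = n by omega] at h3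
  rw [show 2 * ((n - 1) % S.length + 1) - 1 + 2 * ((n - 1) / S.length) * S.length = 2 * n - 1 by
    rw [mul_assoc]; omega] at h4
  rw [h3, h4]
  push_cast
  constructor <;> linarith

/-- A periodic sequence that is doubled, up to an error in `[-q, 0]`, by doubling the index takes
its values in `[0, q]`. -/
theorem mem_Icc_of_doubling {D : ℕ → ℤ} {q C : ℤ} (hC : ∀ m, |D m| ≤ C)
    (hD : ∀ m, 2 * D m - q ≤ D (2 * m) ∧ D (2 * m) ≤ 2 * D m) (m : ℕ) : 0 ≤ D m ∧ D m ≤ q := by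
  have hq : 0 ≤ q := by have := hD 0; simp at this; linarith
  -- A value below 0 or above q would drift away like 2^k, against boundedness.
  have h1 : ∀ k : ℕ, D (2 ^ k * m) ≤ 2 ^ k * D m ∧ 2 ^ k * (D m - q) ≤ D (2 ^ k * m) - q := by
    intro k
    induction k with
    | zero => simp
    | succ k ih =>
      have := hD (2 ^ k * m)
      rw [pow_succ', pow_succ', mul_assoc]
      constructor <;> linarith
  have hCk : C + q < 2 ^ (C + q).toNat := by
    have h2 := Nat.lt_two_pow_self (n := (C + q).toNat)
    zify at h2
    have := Int.self_le_toNat (C + q)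
    linarith
  have hp : (0 : ℤ) < 2 ^ (C + q).toNat := by positivity
  have h3 := h1 (C + q).toNat
  have h4 := abs_le.1 (hC (2 ^ (C + q).toNat * m))
  constructor
  · by_contra! hlt
    nlinarith
  · by_contra! hlt
    nlinarith

theorem Doubles.ones_bounds {S : Word} (h : Doubles S (S ++ S)) (hS : S ≠ []) (n : ℕ) :
    ((n : ℤ) - 1) * weight S ≤ S.length * ones (omegaPow S) n ∧
      S.length * ones (omegaPow S) n ≤ ((n : ℤ) - 1) * weight S + S.length := by
  have q0 := List.length_pos_iff.2 hS
  have hle : weight S ≤ S.length := List.count_le_length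
  -- The shift n = m + 1 turns the index 2n - 1 into 2m + 1, so the deviation from the line is
  -- doubled by m ↦ 2m.
  let D : ℕ → ℤ := fun m => S.length * ones (omegaPow S) (m + 1) - m * weight S
  have hper : ∀ m, D m = D (m % S.length) := by
    intro m
    have h1 := ones_omegaPow_add_mul S (m % S.length + 1) (m / S.length)
    have h2 := Nat.mod_add_div' m S.length
    rw [show m % S.length + 1 + m / S.length * S.length = m + 1 by omega] at h1
    zify at h2
    simp only [D]
    rw [h1]
    push_cast at *
    linear_combination (weight S : ℤ) * h2
  have hfin : ∃ C, ∀ m, |D m| ≤ C := by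
    refine ⟨∑ m ∈ Finset.range S.length, |D m|, fun m => ?_⟩
    rw [hper m]
    exact Finset.single_le_sum (f := fun m => |D m|) (fun i _ => abs_nonneg _)
      (Finset.mem_range.2 (Nat.mod_lt _ q0))
  obtain ⟨C, hC⟩ := hfin
  have key := mem_Icc_of_doubling (q := S.length) hC (fun m => by
    have h1 := h.ones_omegaPow hS (m + 1) (by omega)
    rw [show 2 * (m + 1) - 1 = 2 * m + 1 by omega] at h1
    have q0' : (0 : ℤ) ≤ S.length := by omega
    have h2 := mul_le_mul_of_nonneg_left h1.1 q0'
    have h3 := mul_le_mul_of_nonneg_left h1.2 q0'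
    simp only [D]
    push_cast
    constructor <;> linarith)
  rcases n with _ | n
  · simp
    omega
  · have := key n
    simp only [D] at this
    push_cast
    constructor <;> linarith

theorem length_S6 (a b : ℕ) : (S6 a b).length = (b + 2) * (a + 1) + 1 := by
  rw [S6, List.length_append, length_wordPow, length_oneZeros, length_oneZeros]
  ring

/-! ### Consequences of S² lying in the language of a slope. -/

theorem exists_rounding_of_mem_slopeLanguage {S : Word} {α : ℝ} (h : S ++ S ∈ slopeLanguage α) :
    ∃ (f : ℝ → ℤ) (y : ℝ), IsRounding f ∧
      ∀ n : ℕ, n ≤ 2 * S.length → ones (omegaPow S) n = f (y + n * α) - f y := by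
  obtain ⟨w, hw, i, m, him⟩ := h
  obtain ⟨f, x, hf, hx⟩ := hw.exists_rounding
  refine ⟨f, x + i * α, hf, fun n hn => ?_⟩
  have hm : m = 2 * S.length := by
    have := congrArg List.length him
    rw [length_factorAt, List.length_append] at this
    omega
  rw [hm, ← factorAt_omegaPow_square] at him
  have h1 := ones_of_factorAt_eq him n hn
  rw [zero_add, ones_zero, sub_zero, hx, hx] at h1
  rw [h1]
  push_cast
  rw [show x + (i + n) * α = x + i * α + n * α by ring]
  ring

/-- A rounded arithmetic progression that takes the same value twice is constant in between. -/
theorem IsRounding.const {f : ℝ → ℤ} (hf : IsRounding f) {y δ : ℝ} {k g : ℕ} (hk : k ≤ g)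
    (h : f (y + g * δ) = f y) : f (y + k * δ) = f y := by
  have hk' : (k : ℝ) ≤ g := by exact_mod_cast hk
  have hk0 : (0 : ℝ) ≤ k := Nat.cast_nonneg k
  rcases le_total 0 δ with h0 | h0
  · have h1 := hf.mono (show y ≤ y + k * δ by nlinarith)
    have h2 := hf.mono (show y + k * δ ≤ y + g * δ by nlinarith)
    omega
  · have h1 := hf.mono (show y + k * δ ≤ y by nlinarith)
    have h2 := hf.mono (show y + g * δ ≤ y + k * δ by nlinarith)
    omega

/-- A primitive word that satisfies the doubling inequalities and whose square is Sturmian has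
length coprime to its weight. -/
theorem coprime_of_isPrimitive {S : Word} (hS : S ≠ []) (hprim : IsPrimitive S)
    (hd : Doubles S (S ++ S)) {f : ℝ → ℤ} {y α : ℝ} (hf : IsRounding f)
    (hy : ∀ n : ℕ, n ≤ 2 * S.length → ones (omegaPow S) n = f (y + n * α) - f y) :
    Nat.Coprime S.length (weight S) := by
  have q0 := List.length_pos_iff.2 hS
  obtain ⟨g, hg⟩ : ∃ g, g = Nat.gcd S.length (weight S) := ⟨_, rfl⟩
  have g0 : 0 < g := hg ▸ Nat.gcd_pos_of_pos_left _ q0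
  obtain ⟨d, hd1⟩ : g ∣ S.length := hg ▸ Nat.gcd_dvd_left _ _
  obtain ⟨e, he1⟩ : g ∣ weight S := hg ▸ Nat.gcd_dvd_right _ _
  have hco : Nat.Coprime d e := by
    refine Nat.Coprime.symm (Nat.eq_of_mul_eq_mul_left g0 ?_)
    rw [← Nat.gcd_mul_left, ← hd1, ← he1, Nat.gcd_comm, ← hg, mul_one]
  have d0 : 0 < d := Nat.pos_of_ne_zero fun h => by rw [h] at hd1; omega
  have g0' : (0 : ℤ) < g := by exact_mod_cast g0
  have bd : ∀ n : ℕ, ((n : ℤ) - 1) * e ≤ d * ones (omegaPow S) n ∧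
      d * ones (omegaPow S) n ≤ ((n : ℤ) - 1) * e + d := by
    intro n
    have h1 := hd.ones_bounds hS n
    rw [hd1, he1] at h1
    push_cast at h1
    constructor
    · refine le_of_mul_le_mul_left ?_ g0'
      linarith [h1.1]
    · refine le_of_mul_le_mul_left ?_ g0'
      linarith [h1.2]
  -- At kd + 1 the bounds leave two values. There the count is ke plus a rounding of an arithmetic
  -- progression in k. By periodicity it agrees at k = 0 and k = g, and being monotone it is
  -- constant in between.
  have amb : ∀ k : ℕ, ones (omegaPow S) (k * d + 1) = k * e + ones (omegaPow S) 1 := by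
    have lt : ∀ k ≤ g, ones (omegaPow S) (k * d + 1) =
        k * e + (f (y + α + k * (d * α - e)) - f y) := by
      intro k hk
      have h1 : k * d ≤ g * d := Nat.mul_le_mul_right _ hk
      rw [hy _ (by omega)]
      have h2 : y + (k * d + 1 : ℕ) * α = y + α + k * (d * α - e) + ((k * e : ℤ) : ℝ) := by
        push_cast
        ring
      rw [h2, hf.add_int]
      ring
    have per : ∀ n t : ℕ, ones (omegaPow S) ((n + t * g) * d + 1) =
        ones (omegaPow S) (n * d + 1) + t * (g * e) := by
      intro n t
      have := ones_omegaPow_add_mul S (n * d + 1) t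
      rw [show n * d + 1 + t * S.length = (n + t * g) * d + 1 by rw [hd1]; ring, he1] at this
      rw [this]
      push_cast
      ring
    have e0 : f (y + α) - f y = ones (omegaPow S) 1 := by
      have := lt 0 (Nat.zero_le _)
      simpa using this.symm
    have eg : f (y + α + g * (d * α - e)) = f (y + α) := by
      have h1 := lt g le_rfl
      have h2 := per 0 1
      simp only [zero_add, one_mul, zero_mul, Nat.cast_one] at h2
      linarith
    intro k
    have h1 := lt (k % g) (Nat.mod_lt _ g0).le
    rw [hf.const (Nat.mod_lt k g0).le eg, e0] at h1
    have h2 := per (k % g) (k / g)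
    rw [Nat.mod_add_div' k g, h1] at h2
    rw [h2]
    have h3 := Nat.mod_add_div' k g
    zify at h3
    push_cast
    linear_combination (e : ℤ) * h3
  have shift : ∀ n : ℕ, ones (omegaPow S) (n + 1 + d) = ones (omegaPow S) (n + 1) + e := by
    intro n
    by_cases hn : d ∣ n
    · obtain ⟨k, rfl⟩ := hn
      rw [show d * k + 1 + d = (k + 1) * d + 1 by ring, show d * k + 1 = k * d + 1 by ring, amb,
        amb]
      push_cast
      ring
    · have hne : ∀ z : ℤ, (n : ℤ) * e ≠ d * z := by
        intro z hz
        have h1 : (d : ℤ) ∣ n * e := ⟨z, hz⟩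
        have h2 := IsCoprime.dvd_of_dvd_mul_right (Nat.isCoprime_iff_coprime.2 hco) h1
        exact hn (Int.natCast_dvd_natCast.1 h2)
      have b1 := bd (n + 1)
      have b2 := bd (n + 1 + d)
      have n1 := hne (ones (omegaPow S) (n + 1))
      push_cast at b1 b2
      rw [add_sub_cancel_right] at b1
      have b3 : ((n : ℤ) + 1 + d - 1) * e = n * e + d * e := by ring
      rw [b3] at b2
      have n2 := hne (ones (omegaPow S) (n + 1) - 1)
      have b4 : (n : ℤ) * e < d * ones (omegaPow S) (n + 1) := lt_of_le_of_ne b1.1 n1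
      have b5 : (d : ℤ) * ones (omegaPow S) (n + 1) < n * e + d := by
        refine lt_of_le_of_ne b1.2 fun h => n2 ?_
        rw [mul_sub, h]
        ring
      refine IsBlockWord.eq_of_near (q := d) ?_ ?_ <;> rw [mul_add] <;> linarith
  -- All counts now advance by e over d letters, so d is a period and S is a g-th power. Going round
  -- a full period also reaches the letter 0, which `shift` omits.
  have letters : ∀ n, omegaPow S (n + d) = omegaPow S n := by
    have h1 : ∀ n, omegaPow S (n + 1 + d) = omegaPow S (n + 1) := fun n => by
      refine letter_eq_of_ones ?_
      have h2 := shift n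
      have h3 := shift (n + 1)
      rw [show n + 1 + 1 + d = n + 1 + d + 1 by ring] at h3
      linarith
    intro n
    have h2 := h1 (n + (S.length - 1))
    rw [show n + (S.length - 1) + 1 + d = n + d + S.length by omega,
      show n + (S.length - 1) + 1 = n + S.length by omega, omegaPow_add_length,
      omegaPow_add_length] at h2
    exact h2
  have hpow := wordPow_factorAt_of_periodic letters g
  rw [← hd1, factorAt_omegaPow] at hpow
  have := hprim _ _ hpow
  rw [Nat.Coprime, ← hg, this]

section Windows

variable {S : Word} {f : ℝ → ℤ} {y α : ℝ}

/-- By periodicity the window may start in the first period, and then it lies inside S². -/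
theorem ones_window (hf : IsRounding f)
    (hy : ∀ n : ℕ, n ≤ 2 * S.length → ones (omegaPow S) n = f (y + n * α) - f y) {d : ℕ}
    (hd : d ≤ S.length) (hS : S ≠ []) (n : ℕ) :
    |((ones (omegaPow S) (n + d) - ones (omegaPow S) n : ℤ) : ℝ) - d * α| < 1 := by
  have q0 := List.length_pos_iff.2 hS
  have hlt := Nat.mod_lt n q0
  have h1 := ones_omegaPow_add_mul S (n % S.length) (n / S.length)
  have h2 := ones_omegaPow_add_mul S (n % S.length + d) (n / S.length)
  have h3 := Nat.mod_add_div' n S.length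
  rw [h3, hy (n % S.length) (by omega)] at h1
  rw [show n % S.length + d + n / S.length * S.length = n + d by omega,
    hy (n % S.length + d) (by omega)] at h2
  rw [h1, h2]
  have h4 := hf.lt_one (y + (n % S.length + d : ℕ) * α) (y + (n % S.length : ℕ) * α)
  convert h4 using 2
  push_cast
  ring

/-- Here q = |S| consecutive windows of length d fill exactly d periods, and each has at most `B`
letters 1. -/
theorem mul_weight_le (hf : IsRounding f)
    (hy : ∀ n : ℕ, n ≤ 2 * S.length → ones (omegaPow S) n = f (y + n * α) - f y) {d : ℕ}
    (hd : d ≤ S.length) (hS : S ≠ []) {B : ℕ} (hB : d * α ≤ B) :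
    d * weight S ≤ S.length * B := by
  have h1 : ∀ k : ℕ, ones (omegaPow S) (k * d) ≤ k * B := by
    intro k
    induction k with
    | zero => simp
    | succ k ih =>
      have h2 := (abs_lt.1 (ones_window hf hy hd hS (k * d))).2
      have h3 : ones (omegaPow S) (k * d + d) - ones (omegaPow S) (k * d) < B + 1 := by
        have : ((ones (omegaPow S) (k * d + d) - ones (omegaPow S) (k * d) : ℤ) : ℝ) < B + 1 := by
          linarith
        exact_mod_cast this
      rw [add_mul, one_mul]
      push_cast
      linarith
  have h2 := h1 S.length
  have h3 := ones_omegaPow_add_mul S 0 d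
  rw [zero_add, ones_zero, zero_add, mul_comm] at h3
  rw [h3] at h2
  exact_mod_cast h2

theorem le_mul_weight (hf : IsRounding f)
    (hy : ∀ n : ℕ, n ≤ 2 * S.length → ones (omegaPow S) n = f (y + n * α) - f y) {d : ℕ}
    (hd : d ≤ S.length) (hS : S ≠ []) {B : ℕ} (hB : B ≤ d * α) :
    S.length * B ≤ d * weight S := by
  have h1 : ∀ k : ℕ, k * B ≤ ones (omegaPow S) (k * d) := by
    intro k
    induction k with
    | zero => simp
    | succ k ih =>
      have h2 := (abs_lt.1 (ones_window hf hy hd hS (k * d))).1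
      have h3 : (B : ℤ) - 1 < ones (omegaPow S) (k * d + d) - ones (omegaPow S) (k * d) := by
        have : (B : ℝ) - 1 <
            ((ones (omegaPow S) (k * d + d) - ones (omegaPow S) (k * d) : ℤ) : ℝ) := by
          linarith
        exact_mod_cast this
      rw [add_mul, one_mul]
      push_cast
      linarith
  have h2 := h1 S.length
  have h3 := ones_omegaPow_add_mul S 0 d
  rw [zero_add, ones_zero, zero_add, mul_comm] at h3
  rw [h3] at h2
  exact_mod_cast h2

end Windows

theorem IsSeed.ne_nil {a b : ℕ} {S : Word} (h : IsSeed a b S) : S ≠ [] := h.2.1.1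

theorem IsSeed.length_lt {a b : ℕ} {S : Word} (h : IsSeed a b S) :
    (b + 2) * (a + 1) + 1 < S.length := by
  rw [← length_S6]
  exact h.2.2.1

theorem IsSeed.weight_bounds {a b : ℕ} {S : Word} (h : IsSeed a b S) :
    ((b + 2) * (a + 1) + 1) * weight S ≤ S.length * (b + 2) ∧
      S.length * (b + 1) ≤ ((b + 1) * (a + 1) + 1) * weight S := by
  have hq := h.length_lt
  obtain ⟨-, -, -, α, hα, hS⟩ := id h
  obtain ⟨f, y, hf, hy⟩ := exists_rounding_of_mem_slopeLanguage hS
  obtain ⟨b1, b2⟩ := hα.bounds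
  have e : (b + 2) * (a + 1) = (b + 1) * (a + 1) + (a + 1) := by ring
  constructor
  · refine mul_weight_le hf hy hq.le h.ne_nil ?_
    push_cast at *
    linarith
  · refine le_mul_weight hf hy (by omega) h.ne_nil ?_
    push_cast at *
    linarith

theorem IsSeed.isBlockWord_omegaPow {a b : ℕ} {S : Word} (ha : 1 ≤ a) (h : IsSeed a b S) :
    IsBlockWord S.length (weight S) (fun _ => ones (omegaPow S) 1) (omegaPow S) where
  coprime := by
    obtain ⟨hprim, hsol, -, α, hα, hS⟩ := id h
    obtain ⟨f, y, hf, hy⟩ := exists_rounding_of_mem_slopeLanguage hS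
    exact coprime_of_isPrimitive h.ne_nil hprim hsol.doubles hf hy
  pos := by
    have h1 := h.weight_bounds.2
    have h2 := List.length_pos_iff.2 h.ne_nil
    by_contra! h0
    have : 0 < S.length * (b + 1) := by positivity
    rw [Nat.le_zero.1 h0] at h1
    omega
  lt := by
    have h1 := h.weight_bounds.1
    have h2 := List.length_pos_iff.2 h.ne_nil
    by_contra! h0
    have h3 : (b + 2) * 2 + 1 ≤ (b + 2) * (a + 1) + 1 := by gcongr; omega
    have h4 := (Nat.mul_le_mul h3 h0).trans h1
    have h5 : ((b + 2) * 2 + 1) * S.length = S.length * (b + 2) + S.length * (b + 3) := by ring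
    have : 0 < S.length * (b + 3) := by positivity
    omega
  letter _ := by
    have := ones_step (omegaPow S) 0
    simp only [zero_add, ones_zero] at this
    omega
  bounds := h.2.1.doubles.ones_bounds h.ne_nil
  block k := by rw [add_comm, ones_omegaPow_add_mul]; ring

/-! ### The blocks of `Γ` -/

theorem exchange_getD {u : Word} (hu : 2 ≤ u.length) (n : ℕ) :
    (exchange u).getD n 0 = u.getD (if n = 0 then 1 else if n = 1 then 0 else n) 0 := by
  match u, hu with
  | x :: y :: t, _ =>
    rcases n with _ | _ | n <;> simp [exchange]

theorem length_iterate_exchange (u : Word) (n : ℕ) : (exchange^[n] u).length = u.length := by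
  induction n with
  | zero => rfl
  | succ n ih => rw [Function.iterate_succ_apply', length_exchange, ih]

theorem iterate_exchange_two_mul_add (u : Word) (k r : ℕ) :
    exchange^[2 * k + r] u = exchange^[r] u := by
  rw [add_comm, Function.iterate_add_apply,
    (show Function.Involutive exchange from exchange_exchange).iterate_two_mul, id]

/-- The number of exchanges applied to the `k`-th block of `Γ`, where `r` exchanges are applied to
the first one. -/
def exchanges (r k : ℕ) : ℕ := if k = 0 then r else padicValNat 3 k

/-- A multiple of 3^K does not affect divisibility by powers up to 3^K, and k < 3^K is divisible by
no higher one. -/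
theorem padicValNat_add_mul_pow {k K m : ℕ} (h0 : k ≠ 0) (hk : k < 3 ^ K) :
    padicValNat 3 (k + m * 3 ^ K) = padicValNat 3 k := by
  have key : ∀ n, n ≤ padicValNat 3 (k + m * 3 ^ K) ↔ n ≤ padicValNat 3 k := by
    intro n
    rw [← padicValNat_dvd_iff_le (by omega), ← padicValNat_dvd_iff_le h0]
    rcases le_or_gt n K with h | h
    · exact (Nat.dvd_add_iff_left ((pow_dvd_pow 3 h).mul_left m)).symm
    · have h1 : ¬ 3 ^ K ∣ k := fun h2 => by
        have := Nat.le_of_dvd (Nat.pos_of_ne_zero h0) h2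
        omega
      have h2 : 3 ^ K ∣ 3 ^ n := pow_dvd_pow 3 h.le
      constructor
      · intro h3
        exact absurd ((Nat.dvd_add_iff_left (Dvd.intro_left m rfl)).2 (h2.trans h3)) h1
      · intro h3
        exact absurd (h2.trans h3) h1
  exact le_antisymm ((key _).1 le_rfl) ((key _).2 le_rfl)

/-- Each recursion step exchanges only block 0 of the leading copy. All other blocks are frozen, so
the count of exchanges follows the ternary expansion of k. -/
theorem gammaWord_getD {S : Word} (hS : 2 ≤ S.length) (K k j : ℕ) (hk : k < 3 ^ K)
    (hj : j < S.length) :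
    (gammaWord S K).getD (k * S.length + j) 0 = (exchange^[exchanges K k] S).getD j 0 := by
  induction K generalizing k j with
  | zero =>
    obtain rfl : k = 0 := by simpa using hk
    simp [gammaWord, exchanges]
  | succ K ih =>
    have hlen := length_gammaWord S K
    have hlen2 : 2 ≤ (gammaWord S K).length := by
      rw [hlen]
      exact hS.trans (Nat.le_mul_of_pos_left _ (by positivity))
    -- In the two unexchanged copies, the initial block has seen K exchanges, which is v₃(m · 3^K)
    -- for m = 1, 2.
    have inner : ∀ m k', (m = 1 ∨ m = 2) → k' < 3 ^ K → k = k' + m * 3 ^ K →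
        (gammaWord S K).getD (k' * S.length + j) 0 =
          (exchange^[exchanges (K + 1) k] S).getD j 0 := by
      intro m k' hm hk' e
      rw [ih k' j hk' hj]
      congr 2
      have hne : k ≠ 0 := by
        have : 0 < 3 ^ K := by positivity
        rcases hm with rfl | rfl <;> omega
      unfold exchanges
      rw [if_neg hne]
      split_ifs with h0
      · rw [e, h0, zero_add, padicValNat.mul (by omega) (by positivity), padicValNat.prime_pow]
        rcases hm with rfl | rfl
        · simp
        · rw [padicValNat.eq_zero_of_not_dvd (by decide), zero_add]
      · rw [e, padicValNat_add_mul_pow h0 hk']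
    have lt_mul : ∀ k', k' < 3 ^ K → k' * S.length + j < (gammaWord S K).length := by
      intro k' hk'
      rw [hlen]
      calc k' * S.length + j < (k' + 1) * S.length := by rw [add_mul]; omega
        _ ≤ 3 ^ K * S.length := Nat.mul_le_mul_right _ hk'
    change (exchange (gammaWord S K) ++ (gammaWord S K ++ gammaWord S K)).getD _ 0 = _
    rcases lt_or_ge k (3 ^ K) with h1 | h1
    · rw [List.getD_append _ _ _ _ (by rw [length_exchange]; exact lt_mul k h1),
        exchange_getD hlen2]
      rcases Nat.eq_zero_or_pos k with rfl | hk0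
      · have h2 := ih 0 (if j = 0 then 1 else if j = 1 then 0 else j) h1 (by split_ifs <;> omega)
        rw [zero_mul, zero_add] at h2 ⊢
        rw [h2]
        simp only [exchanges, if_true, Function.iterate_succ_apply']
        rw [exchange_getD (by rw [length_iterate_exchange]; exact hS)]
      · have h2 : S.length ≤ k * S.length := Nat.le_mul_of_pos_left _ hk0
        rw [if_neg (by omega), if_neg (by omega), ih k j h1 hj]
        simp [exchanges, hk0.ne']
    · have h2 : 3 ^ K * S.length ≤ k * S.length := Nat.mul_le_mul_right _ h1
      rw [List.getD_append_right _ _ _ _ (by rw [length_exchange, hlen]; omega), length_exchange,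
        hlen]
      rcases lt_or_ge k (2 * 3 ^ K) with h3 | h3
      · have h4 : k * S.length + j - 3 ^ K * S.length = (k - 3 ^ K) * S.length + j := by
          rw [Nat.sub_mul]
          omega
        rw [h4, List.getD_append _ _ _ _ (lt_mul _ (by omega))]
        exact inner 1 _ (Or.inl rfl) (by omega) (by omega)
      · have h5 : 2 * 3 ^ K * S.length ≤ k * S.length := Nat.mul_le_mul_right _ h3
        have h6 : 2 * 3 ^ K * S.length = 3 ^ K * S.length + 3 ^ K * S.length := by ring
        have h4 : k * S.length + j - 3 ^ K * S.length - 3 ^ K * S.length =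
            (k - 2 * 3 ^ K) * S.length + j := by
          rw [Nat.sub_mul]
          omega
        rw [List.getD_append_right _ _ _ _ (by rw [hlen]; omega), hlen, h4]
        rw [pow_succ] at hk
        exact inner 2 _ (Or.inr rfl) (by omega) (by omega)

theorem gammaLimit_apply {S : Word} (hS : 2 ≤ S.length) (r k j : ℕ) (hj : j < S.length) :
    gammaLimit S r (k * S.length + j) = (exchange^[exchanges r k] S).getD j 0 := by
  have hk : k < 3 ^ (2 * k + r) := by
    calc k < 3 ^ k := Nat.lt_pow_self (by norm_num)
      _ ≤ 3 ^ (2 * k + r) := Nat.pow_le_pow_right (by norm_num) (by omega)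
  have hlen : k * S.length + j < (gammaWord S (2 * k + r)).length := by
    rw [length_gammaWord]
    calc k * S.length + j < (k + 1) * S.length := by rw [add_mul]; omega
      _ ≤ _ := Nat.mul_le_mul_right _ hk
  rw [isPrefixOf_iff.1 (gammaWord_isPrefixOf_gammaLimit S hS r k) _ hlen,
    ← List.getD_eq_getElem _ 0 hlen, gammaWord_getD hS _ _ _ hk hj]
  unfold exchanges
  split_ifs
  · rw [iterate_exchange_two_mul_add]
  · rfl

/-- The first letter of the `k`-th block of `Γ`, as an integer. -/
def firstLetter (S : Word) (r k : ℕ) : ℤ := ((exchange^[exchanges r k] S).getD 0 0).val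

/-- Doubling preserves the 3-adic valuation; this is the self-similarity needed in `root_mem`. -/
theorem exchanges_two_mul (r k : ℕ) : exchanges r (2 * k) = exchanges r k := by
  unfold exchanges
  rcases Nat.eq_zero_or_pos k with rfl | h
  · simp
  · rw [if_neg (by omega), if_neg h.ne', padicValNat.mul (by omega) h.ne',
      padicValNat.eq_zero_of_not_dvd (by decide), zero_add]

/-- This supplies the odd almost-period 3^N for `root_mem`. -/
theorem exchanges_add (r : ℕ) {k N : ℕ} (h0 : 1 ≤ k) (h : k ≤ N) :
    exchanges r (k + 3 ^ N) = exchanges r k := by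
  unfold exchanges
  rw [if_neg (Nat.add_pos_left h0 _).ne', if_neg (by omega)]
  have h1 : k < 3 ^ N := h.trans_lt (Nat.lt_pow_self (by norm_num))
  simpa using padicValNat_add_mul_pow (m := 1) (by omega) h1

/-- Swapping the first two letters can alter the count only after one letter. -/
theorem ones_omegaPow_exchange {u : Word} (hu : 2 ≤ u.length) {j : ℕ} (hj : j ≤ u.length)
    (hj1 : j ≠ 1) : ones (omegaPow (exchange u)) j = ones (omegaPow u) j := by
  rcases (show j = 0 ∨ 2 ≤ j by omega) with rfl | h2
  · simp
  · induction j, h2 using Nat.le_induction with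
    | base =>
      rw [ones_succ, ones_succ, ones_succ, ones_succ,
        omegaPow_of_lt (by rw [length_exchange]; omega),
        omegaPow_of_lt (by rw [length_exchange]; omega), omegaPow_of_lt (by omega),
        omegaPow_of_lt (by omega), exchange_getD hu, exchange_getD hu]
      simp
      ring
    | succ j h2 ih =>
      rw [ones_succ, ones_succ, ih (by omega) (by omega),
        omegaPow_of_lt (by rw [length_exchange]; omega), omegaPow_of_lt (by omega),
        exchange_getD hu, if_neg (by omega), if_neg (by omega)]

theorem ones_omegaPow_iterate_exchange {u : Word} (hu : 2 ≤ u.length) {j : ℕ}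
    (hj : j ≤ u.length) (hj1 : j ≠ 1) (n : ℕ) :
    ones (omegaPow (exchange^[n] u)) j = ones (omegaPow u) j := by
  induction n with
  | zero => rfl
  | succ n ih =>
    have h := length_iterate_exchange u n
    rw [Function.iterate_succ_apply', ones_omegaPow_exchange (by omega) (by omega) hj1, ih]

theorem ones_gammaLimit_mul_add {S : Word} (hS : 2 ≤ S.length) (r k : ℕ) :
    ∀ j ≤ S.length, ones (gammaLimit S r) (k * S.length + j) =
      k * weight S + if j = 1 then firstLetter S r k else ones (omegaPow S) j := by
  have inner : ∀ k, ∀ j ≤ S.length, ones (gammaLimit S r) (k * S.length + j) =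
      ones (gammaLimit S r) (k * S.length) +
        if j = 1 then firstLetter S r k else ones (omegaPow S) j := by
    intro k j hj
    have hlen := length_iterate_exchange S (exchanges r k)
    have h1 := ones_congr (u := omegaPow (exchange^[exchanges r k] S)) (w := gammaLimit S r)
      (i := k * S.length) (n := S.length) (fun s hs => by
        rw [gammaLimit_apply hS r k s hs, omegaPow_of_lt (by omega)]) j hj
    rw [← sub_eq_iff_eq_add', ← h1]
    split_ifs with hj1
    · subst hj1
      rw [ones_succ, ones_zero, zero_add, omegaPow_of_lt (by omega)]
      rfl
    · exact ones_omegaPow_iterate_exchange hS hj hj1 _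
  have base : ones (gammaLimit S r) (k * S.length) = k * weight S := by
    induction k with
    | zero => simp
    | succ k ih =>
      have h := inner k S.length le_rfl
      rw [if_neg (by omega), ih, ones_omegaPow_length] at h
      rw [add_mul, one_mul, h]
      push_cast
      ring
  intro j hj
  rw [inner k j hj, base]

theorem firstLetter_eq_zero_or_one (S : Word) (r k : ℕ) :
    firstLetter S r k = 0 ∨ firstLetter S r k = 1 := by
  unfold firstLetter
  have := ((exchange^[exchanges r k] S).getD 0 0).isLt
  omega

theorem isBlockWord_gammaLimit {S : Word} {e : ℤ}
    (h : IsBlockWord S.length (weight S) (fun _ => e) (omegaPow S)) (r : ℕ) :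
    IsBlockWord S.length (weight S) (firstLetter S r) (gammaLimit S r) := by
  have hS : 2 ≤ S.length := by have := h.pos; have := h.lt; omega
  refine ⟨h.coprime, h.pos, h.lt, firstLetter_eq_zero_or_one S r, fun n => ?_, fun k => ?_⟩
  · have hlt := Nat.mod_lt n (show 0 < S.length by omega)
    have h1 := ones_gammaLimit_mul_add hS r (n / S.length) (n % S.length) hlt.le
    have h2 := Nat.div_add_mod' n S.length
    rw [h2] at h1
    rw [h1]
    have h5 : (n : ℤ) = (n / S.length : ℕ) * S.length + (n % S.length : ℕ) := by
      exact_mod_cast h2.symm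
    rw [h5]
    split_ifs with h3
    · rw [h3]
      have h4 := firstLetter_eq_zero_or_one S r (n / S.length)
      rcases h4 with h4 | h4 <;> rw [h4, Nat.cast_one] <;> constructor <;> linarith
    · have h4 := h.bounds (n % S.length)
      constructor <;> linarith
  · rw [ones_gammaLimit_mul_add hS r k 1 (by omega), if_pos rfl]

/-! ### Properties of the union -/

theorem not_isSturmian_of_mem_subshiftOf {v w : InfWord} {d m : ℕ} (hm : m < d) {x : Fin 2}
    (hw : ∀ s, w (m + d * s) = x) (hv : v ∈ subshiftOf w) : ¬ IsSturmian v := by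
  have key : ∀ N, ∃ c : Fin d, ∀ s, c + d * s < N → v (c + d * s) = x := by
    intro N
    obtain ⟨i, hi⟩ := mem_subshiftOf_iff.1 hv N
    have hlt := Nat.mod_lt i (show 0 < d by omega)
    have hdiv := Nat.mod_add_div i d
    rcases le_or_gt (i % d) m with h | h
    · refine ⟨⟨m - i % d, by omega⟩, fun s hs => ?_⟩
      rw [hi _ hs, ← hw (i / d + s), mul_add]
      congr 1
      simp only
      omega
    · refine ⟨⟨m + d - i % d, by omega⟩, fun s hs => ?_⟩
      rw [hi _ hs, ← hw (i / d + s + 1), mul_add, mul_add, mul_one]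
      congr 1
      simp only
      omega
  -- For each N the constant progression has some residue modulo d. One residue occurs for
  -- infinitely many N, hence works for the whole word.
  choose c hc using key
  obtain ⟨c₀, h₀⟩ := Finite.exists_infinite_fiber c
  refine not_isSturmian_of_constant_progression (c := c₀) (d := d) (x := x) (by omega) fun s => ?_
  obtain ⟨N, hN, hlt⟩ := (Set.infinite_coe_iff.1 h₀).exists_gt (c₀ + d * s)
  obtain rfl : c N = c₀ := hN
  exact hc N s hlt

theorem not_mem_subshiftOf_omegaPow {S : Word} {w : InfWord} {i : ℕ}
    (h : w (i + S.length) ≠ w i) : w ∉ subshiftOf (omegaPow S) := by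
  intro hw
  obtain ⟨k, hk⟩ := mem_subshiftOf_iff.1 hw (i + S.length + 1)
  refine h ?_
  rw [hk _ (by omega), hk _ (by omega), ← add_assoc, omegaPow_add_length]

/-- Blocks 2 and 3 are S and L(S), and S begins with two different letters because its first two
letters contain exactly one 1. -/
theorem gammaLimit_ne {S : Word} {e : ℤ}
    (h : IsBlockWord S.length (weight S) (fun _ => e) (omegaPow S)) (r : ℕ) :
    gammaLimit S r (2 * S.length + S.length) ≠ gammaLimit S r (2 * S.length) := by
  have h0 := h.pos
  have h1 := h.lt
  have hS : 2 ≤ S.length := by omega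
  have h2 := h.bounds 2
  have h3 : ones (omegaPow S) 2 = 1 := by
    have hlt : (weight S : ℤ) < S.length := by exact_mod_cast h1
    have hpos : (0 : ℤ) < weight S := by exact_mod_cast h0
    refine IsBlockWord.eq_of_near (q := S.length) ?_ ?_ <;> push_cast at h2 <;> linarith
  have h4 := gammaLimit_apply hS r 2 0 (by omega)
  have h5 := gammaLimit_apply hS r 3 0 (by omega)
  have e2 : exchanges r 2 = 0 := by
    rw [exchanges, if_neg (by omega), padicValNat.eq_zero_of_not_dvd (by decide)]
  have e3 : exchanges r 3 = 1 := by
    rw [exchanges, if_neg (by omega)]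
    exact padicValNat_self
  rw [e2, add_zero, Function.iterate_zero, id] at h4
  rw [e3, add_zero, Function.iterate_one, exchange_getD hS, if_pos rfl] at h5
  rw [show 2 * S.length + S.length = 3 * S.length by ring, h4, h5]
  intro h6
  rw [ones_succ, ones_succ, ones_zero, omegaPow_of_lt (by omega), omegaPow_of_lt (by omega), h6]
    at h3
  omega

/-- Blocks numbered 3s + 1 have valuation 0, hence are equal to S. -/
theorem gammaLimit_progression {S : Word} (hS : 2 ≤ S.length) (r s : ℕ) :
    gammaLimit S r (S.length + 3 * S.length * s) = S.getD 0 0 := by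
  have h := gammaLimit_apply hS r (3 * s + 1) 0 (by omega)
  rw [exchanges, if_neg (by omega), padicValNat.eq_zero_of_not_dvd (by omega)] at h
  rw [show S.length + 3 * S.length * s = (3 * s + 1) * S.length + 0 by ring, h]
  rfl

/-! ### Existence of seed solutions -/

theorem lowerCoding_eq_zero {α x : ℝ} {n : ℕ} (m : ℤ) (h1 : m ≤ x + n * α)
    (h2 : x + n * α < m + 1 - α) (h0 : 0 < α) : lowerCoding α x n = 0 := by
  have : Int.fract (x + n * α) = x + n * α - m := by
    rw [Int.fract_eq_iff]
    exact ⟨by linarith, by linarith, m, by ring⟩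
  unfold lowerCoding
  rw [if_pos (by rw [this]; linarith)]

theorem lowerCoding_eq_one {α x : ℝ} {n : ℕ} (m : ℤ) (h1 : m + 1 - α ≤ x + n * α)
    (h2 : x + n * α < m + 1) (h0 : α < 1) : lowerCoding α x n = 1 := by
  have : Int.fract (x + n * α) = x + n * α - m := by
    rw [Int.fract_eq_iff]
    exact ⟨by linarith, by linarith, m, by ring⟩
  unfold lowerCoding
  rw [if_neg (by rw [this]; linarith)]

theorem sqrt_five_bounds : (2.236 : ℝ) < √5 ∧ √5 < 2.2361 := by
  constructor
  · apply Real.lt_sqrt_of_sq_lt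
    norm_num
  · rw [Real.sqrt_lt' (by norm_num)]
    norm_num

theorem irrational_golden : Irrational ((3 - √5) / 2) := by
  have h : Irrational √5 := by
    have := Nat.Prime.irrational_sqrt (show Nat.Prime 5 by norm_num)
    exact_mod_cast this
  have h2 := (h.natCast_sub 3).div_natCast (show (2 : ℕ) ≠ 0 by norm_num)
  exact_mod_cast h2

theorem hasExpansion_golden : HasExpansion ((3 - √5) / 2) 2 1 := by
  obtain ⟨b1, b2⟩ := sqrt_five_bounds
  have hsq : √5 * √5 = 5 := Real.mul_self_sqrt (by norm_num)
  have h0 : 0 < (3 - √5) / 2 := by linarith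
  have h1 : (3 - √5) / 2 < 1 := by linarith
  have hfr : Int.fract ((3 - √5) / 2) = (3 - √5) / 2 := Int.fract_eq_self.2 ⟨h0.le, h1⟩
  have hinv : ((3 - √5) / 2)⁻¹ = (3 + √5) / 2 := by
    apply inv_eq_of_mul_eq_one_right
    linarith
  have hfl : ⌊(3 + √5) / 2⌋ = 2 := by
    rw [Int.floor_eq_iff]
    push_cast
    constructor <;> linarith
  have hfr2 : Int.fract ((3 + √5) / 2) = (√5 - 1) / 2 := by
    rw [← Int.self_sub_floor, hfl]
    push_cast
    ring
  have hinv2 : ((√5 - 1) / 2)⁻¹ = (√5 + 1) / 2 := by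
    apply inv_eq_of_mul_eq_one_right
    linarith
  have hfl2 : ⌊(√5 + 1) / 2⌋ = 1 := by
    rw [Int.floor_eq_iff]
    push_cast
    constructor <;> linarith
  have e0 : (GenContFract.of ((3 - √5) / 2)).s.get? 0 = some ⟨1, ((2 : ℤ) : ℝ)⟩ := by
    have := GenContFract.of_s_head (v := (3 - √5) / 2) (by rw [hfr]; exact h0.ne')
    rwa [hfr, hinv, hfl] at this
  have e1 : (GenContFract.of ((3 - √5) / 2)).s.get? 1 = some ⟨1, ((1 : ℤ) : ℝ)⟩ := by
    rw [GenContFract.of_s_succ, hfr, hinv]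
    have := GenContFract.of_s_head (v := (3 + √5) / 2) (by rw [hfr2]; linarith)
    rwa [hfr2, hinv2, hfl2] at this
  refine ⟨irrational_golden, h0, h1, ?_, ?_⟩
  · simp [GenContFract.partDens, Stream'.Seq.map_get?, e0]
  · simp [GenContFract.partDens, Stream'.Seq.map_get?, e1]

theorem isSeed_example : IsSeed 1 0 [0, 1, 0, 1, 0, 0, 1, 0] := by
  -- The factorization is S₂ · S₁ · S₆ for a = 1, b = 0. With slope (3 - √5)/2 and intercept 11/20,
  -- the first 16 letters of the coding spell S².
  refine ⟨?_, ⟨by simp, [[0, 1], [0], [1, 0, 0, 1, 0]], ?_, rfl, rfl⟩, by decide,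
    (3 - √5) / 2, hasExpansion_golden, lowerCoding ((3 - √5) / 2) (11 / 20),
    ⟨irrational_golden, hasExpansion_golden.2.1, hasExpansion_golden.2.2.1, _, Or.inl rfl⟩,
    0, 16, ?_⟩
  · intro z n h
    have hlen := congrArg List.length h
    rw [length_wordPow] at hlen
    have hn : n ∣ 8 := ⟨z.length, hlen⟩
    have hn8 := Nat.le_of_dvd (by norm_num) hn
    interval_cases n <;> simp at hlen hn ⊢
    · match z, hlen with
      | [_, _, _, _], _ => simp [wordPow] at h; omega
    · match z, hlen with
      | [_, _], _ => simp [wordPow] at h; omega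
    · match z, hlen with
      | [_], _ =>
        simp [wordPow] at h
        exact absurd (h.1.trans h.2.1.symm) (by decide)
  · intro u hu
    simp only [List.mem_cons, List.not_mem_nil, or_false] at hu
    simp only [minimalSquareRoots, Set.mem_insert_iff, Set.mem_singleton_iff]
    rcases hu with rfl | rfl | rfl <;> decide
  · symm
    change IsPrefixOf ([0, 1, 0, 1, 0, 0, 1, 0] ++ [0, 1, 0, 1, 0, 0, 1, 0]) _
    refine isPrefixOf_iff.2 fun s hs => ?_
    obtain ⟨b1, b2⟩ := sqrt_five_bounds
    obtain ⟨_, h0, h1, -⟩ := hasExpansion_golden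
    change s < 16 at hs
    -- The integer `m` is the floor of the orbit point.
    have zero : ∀ (n : ℕ) (m : ℤ), (m : ℝ) ≤ 11 / 20 + n * ((3 - √5) / 2) →
        11 / 20 + n * ((3 - √5) / 2) < m + 1 - (3 - √5) / 2 →
        lowerCoding ((3 - √5) / 2) (11 / 20) n = 0 := fun n m h2 h3 =>
      lowerCoding_eq_zero m h2 h3 h0
    have one : ∀ (n : ℕ) (m : ℤ), (m : ℝ) + 1 - (3 - √5) / 2 ≤ 11 / 20 + n * ((3 - √5) / 2) →
        11 / 20 + n * ((3 - √5) / 2) < m + 1 →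
        lowerCoding ((3 - √5) / 2) (11 / 20) n = 1 := fun n m h2 h3 =>
      lowerCoding_eq_one m h2 h3 h1
    interval_cases s
    · exact zero 0 0 (by push_cast; linarith) (by push_cast; linarith)
    · exact one 1 0 (by push_cast; linarith) (by push_cast; linarith)
    · exact zero 2 1 (by push_cast; linarith) (by push_cast; linarith)
    · exact one 3 1 (by push_cast; linarith) (by push_cast; linarith)
    · exact zero 4 2 (by push_cast; linarith) (by push_cast; linarith)
    · exact zero 5 2 (by push_cast; linarith) (by push_cast; linarith)
    · exact one 6 2 (by push_cast; linarith) (by push_cast; linarith)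
    · exact zero 7 3 (by push_cast; linarith) (by push_cast; linarith)
    · exact zero 8 3 (by push_cast; linarith) (by push_cast; linarith)
    · exact one 9 3 (by push_cast; linarith) (by push_cast; linarith)
    · exact zero 10 4 (by push_cast; linarith) (by push_cast; linarith)
    · exact one 11 4 (by push_cast; linarith) (by push_cast; linarith)
    · exact zero 12 5 (by push_cast; linarith) (by push_cast; linarith)
    · exact zero 13 5 (by push_cast; linarith) (by push_cast; linarith)
    · exact one 14 5 (by push_cast; linarith) (by push_cast; linarith)
    · exact zero 15 6 (by push_cast; linarith) (by push_cast; linarith)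

end SquareRootMap

theorem mainTheorem12 :
    (∃ (a b : ℕ) (S : SquareRootMap.Word), 1 ≤ a ∧ SquareRootMap.IsSeed a b S) ∧
    ∀ (a b : ℕ) (S : SquareRootMap.Word), 1 ≤ a → SquareRootMap.IsSeed a b S →
      ∀ r ∈ ({0, 1} : Set ℕ),
        SquareRootMap.IsSubshift (SquareRootMap.unionSubshift S r) ∧
        ¬ SquareRootMap.IsMinimalSubshift (SquareRootMap.unionSubshift S r) ∧
        ¬ SquareRootMap.IsSturmianSubshift (SquareRootMap.unionSubshift S r) ∧
        (∀ w ∈ SquareRootMap.unionSubshift S r, ¬ SquareRootMap.IsSturmian w) ∧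
        (∀ w ∈ SquareRootMap.unionSubshift S r, SquareRootMap.IsSquareful w) ∧
        (∀ w ∈ SquareRootMap.unionSubshift S r, ∃! v, SquareRootMap.IsSquareRoot v w) ∧
        SquareRootMap.sqrtImage (SquareRootMap.unionSubshift S r) ⊆
          SquareRootMap.unionSubshift S r := by
  refine ⟨⟨1, 0, _, le_rfl, SquareRootMap.isSeed_example⟩, fun a b S ha hseed r _ => ?_⟩
  have hp := hseed.isBlockWord_omegaPow ha
  have hg := SquareRootMap.isBlockWord_gammaLimit hp r
  have hS : 2 ≤ S.length := by
    have := hp.pos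
    have := hp.lt
    omega
  obtain ⟨w1, w2⟩ := hseed.weight_bounds
  have rp := hp.runBounds (by omega) hseed.length_lt w1 w2
  have rg := hg.runBounds (by omega) hseed.length_lt w1 w2
  have run : ∀ w ∈ SquareRootMap.unionSubshift S r,
      SquareRootMap.RunBounds (a + 1) b (SquareRootMap.ones w) := by
    rintro w (hw | hw)
    · exact rg.of_mem_subshiftOf hw
    · exact rp.of_mem_subshiftOf hw
  have nonSturmian : ∀ w ∈ SquareRootMap.unionSubshift S r, ¬ SquareRootMap.IsSturmian w := by
    rintro w (hw | hw)
    · exact SquareRootMap.not_isSturmian_of_mem_subshiftOf (by omega)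
        (SquareRootMap.gammaLimit_progression hS r) hw
    · refine SquareRootMap.not_isSturmian_of_mem_subshiftOf (m := 0) (d := S.length)
        (x := S.getD 0 0) (by omega) (fun s => ?_) hw
      simp [SquareRootMap.omegaPow]
  refine ⟨SquareRootMap.isSubshift_union _ _, ?_, ?_, nonSturmian,
    fun w hw => (run w hw).isSquareful (by omega),
    fun w hw => (run w hw).existsUnique_isSquareRoot (by omega), ?_⟩
  · intro hmin
    refine hmin.2 _ (SquareRootMap.isSubshift_subshiftOf (SquareRootMap.omegaPow S))
      ⟨_, SquareRootMap.self_mem_subshiftOf _⟩ ⟨Set.subset_union_right, fun hsub => ?_⟩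
    exact SquareRootMap.not_mem_subshiftOf_omegaPow (SquareRootMap.gammaLimit_ne hp r)
      (hsub (Or.inl (SquareRootMap.self_mem_subshiftOf _)))
  · rintro ⟨w, hw, heq⟩
    exact nonSturmian w (heq ▸ SquareRootMap.self_mem_subshiftOf w) hw
  · rintro v ⟨w, hw | hw, hvw⟩
    · refine hg.root_mem hp (fun k => ?_) (fun N => ⟨3 ^ N, Odd.pow (by decide), fun k h1 h2 => ?_⟩)
        rg (by omega) hw hvw
      · simp only [SquareRootMap.firstLetter, SquareRootMap.exchanges_two_mul]
      · simp only [SquareRootMap.firstLetter, SquareRootMap.exchanges_add r h1 h2]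
    -- All blocks of S^ω begin alike, so M = 1 serves and both alternatives are Ω_{S^ω}.
    · have := hp.root_mem hp (fun _ => rfl) (fun N => ⟨1, odd_one, fun _ _ _ => rfl⟩) rp
        (by omega) hw hvw
      exact Or.inr (this.elim id id)
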